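/- **Notation.** For $F\subset\mathbb R^d$ let $F_\varepsilon=\{x : d(x,F)\le\varepsilon\}$ be its $\varepsilon$-parallel set, and let $\mathcal R^d$ be the convex ring, i.e. the class of finite unions of compact convex subsets of $\mathbb R^d$. For compact convex $K$ with nearest-point map $p_K$, the curvature measures $C_0(K,\cdot),\dots,C_d(K,\cdot)$ are defined by the local Steiner formula $$\mathcal L^d\big(p_K^{-1}(B)\cap K_\varepsilon\big)=\sum_{j=0}^d\varepsilon^{d-j}\kappa_{d-j}\,C_j(K,B)\qquad(\varepsilon>0,\ B\text{ Borel}),$$ where $\kappa_j$ is the volume of the $j$-dimensional unit ball; they are extended to signed measures $C_j(F,\cdot)$ for $F\in\mathcal R^d$ by the inclusion–exclusion principle. Write $C_j(F)=C_j(F,\mathbb R^d)$ and let $C_j^{var}(F)$ be the total mass of the total variation measure of $C_j(F,\cdot)$. The scaling exponents are $$s_j(F)=\inf\{t\in\mathbb R:\lim_{\varepsilon\downarrow0}\varepsilon^tC_j^{var}(F_\varepsilon)=0\},$$ and for compact $F$ with $F_\varepsilon\in\mathcal R^d$ for all $\varepsilon\in(0,\varepsilon_0]$, some $\varepsilon_0>0$,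 the average fractal curvatures are $$\overline C_j^f(F)=\lim_{\delta\downarrow0}\frac1{\log\varepsilon_0-\log\delta}\int_\delta^{\varepsilon_0}\varepsilon^{s_j(F)}C_j(F_\varepsilon)\,\frac{d\varepsilon}{\varepsilon}$$ whenever $s_j(F)$ is finite and the integrals and the limit exist. For a compact set $A\subset\mathbb R^d$, the specific fractal curvatures $$\Xi_k(A)=\overline C_k^f(A)/\overline C_d^f(A),\qquad k\in\{0,\dots,d-1\},$$ are called well defined if $\overline C_j^f(A)$ exists for all $j\in\{0,\dots,d\}$ and $\overline C_d^f(A)>0$. **Proposition.** Let $A\subset\mathbb R^d$ be a compact set whose specific fractal curvatures are well defined, let $k\in\{0,\dots,d-1\}$ and $\lambda>0$. 1. If $A\in\mathcal R^d$ and $A$ has positive volume, then $\Xi_k(\lambda A)$ is well defined and $\Xi_k(\lambda A)=\lambda^{k-d}\,\Xi_k(A)$. 2. If there is a real number $s$ with $s_j(A)=s-j$ for all $j\in\{0,\dots,d\}$, then $\Xi_k(\lambda A)$ is well defined and $\Xi_k(\lambda A)=\Xi_k(A)$. -/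

import Mathlib

open Set Filter Topology MeasureTheory
open scoped Pointwise

namespace FractalCurvature

noncomputable section

/-- Euclidean space `ℝ^d`. -/
abbrev E (d : ℕ) : Type := EuclideanSpace ℝ (Fin d)

/-- `κ_j`, the volume of the `j`-dimensional Euclidean unit ball. -/
def unitBallVolume (j : ℕ) : ℝ := (volume (Metric.closedBall (0 : E j) 1)).toReal

/-- The local parallel set `U_ε(K, B) = p_K⁻¹(B) ∩ K_ε`: all points at distance at most `ε` from
`K` whose nearest point in `K` lies in `B`. -/
def localParallelSet {d : ℕ} (ε : ℝ) (K B : Set (E d)) : Set (E d) :=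
  {x | ∃ y ∈ K ∩ B, (∀ z ∈ K, dist x y ≤ dist x z) ∧ dist x y ≤ ε}

/-- `c 0, …, c d` are the coefficients in the local Steiner formula of `K` at `B`. -/
def IsSteinerCoeff {d : ℕ} (K B : Set (E d)) (c : Fin (d + 1) → ℝ) : Prop :=
  ∀ ε : ℝ, 0 < ε → (volume (localParallelSet ε K B)).toReal =
    ∑ j : Fin (d + 1), ε ^ (d - (j : ℕ)) * unitBallVolume (d - (j : ℕ)) * c j

open Classical in
/-- The curvature measures `C_j(K, B)` of a compact convex set `K`, for a Borel set `B`: the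
coefficients in the local Steiner formula (these are unique). -/
def convexCurvature {d : ℕ} (j : Fin (d + 1)) (K B : Set (E d)) : ℝ :=
  if h : ∃ c : Fin (d + 1) → ℝ, IsSteinerCoeff K B c then h.choose j else 0

/-- `K 0, …, K (m-1)` are compact convex sets with union `F`. -/
def IsConvexRepr {d : ℕ} (F : Set (E d)) (m : ℕ) (K : Fin m → Set (E d)) : Prop :=
  (∀ i, IsCompact (K i) ∧ Convex ℝ (K i)) ∧ F = ⋃ i, K i

/-- `F` belongs to the convex ring, i.e. it is a finite union of compact convex sets. -/
def IsPolyconvex {d : ℕ} (F : Set (E d)) : Prop :=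
  ∃ (m : ℕ) (K : Fin m → Set (E d)), IsConvexRepr F m K

open Classical in
/-- The (signed) curvature measures `C_j(F, B)` of a polyconvex set `F`, by inclusion-exclusion
over a representation of `F` as a finite union of compact convex sets. (The value does not depend
on the representation.) -/
def curvature {d : ℕ} (j : Fin (d + 1)) (F B : Set (E d)) : ℝ :=
  if h : IsPolyconvex F then
    ∑ I : Finset (Fin h.choose) with I.Nonempty,
      (-1 : ℝ) ^ (I.card - 1) * convexCurvature j (⋂ i ∈ I, h.choose_spec.choose i) B
  else 0

/-- The total curvature `C_j(F) = C_j(F, ℝ^d)`. -/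
def totalCurvature {d : ℕ} (j : Fin (d + 1)) (F : Set (E d)) : ℝ := curvature j F univ

/-- The positive variation `μ⁺(A)` of a signed measure `μ`. -/
def posVariation {d : ℕ} (μ : Set (E d) → ℝ) (A : Set (E d)) : ℝ :=
  sSup {x | ∃ B, MeasurableSet B ∧ B ⊆ A ∧ x = μ B}

/-- The negative variation `μ⁻(A)` of a signed measure `μ`. -/
def negVariation {d : ℕ} (μ : Set (E d) → ℝ) (A : Set (E d)) : ℝ :=
  -sInf {x | ∃ B, MeasurableSet B ∧ B ⊆ A ∧ x = μ B}

/-- The total variation `C_j^var(F)` of the signed measure `C_j(F, ·)`. -/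
def curvatureVar {d : ℕ} (j : Fin (d + 1)) (F : Set (E d)) : ℝ :=
  posVariation (curvature j F) univ + negVariation (curvature j F) univ

/-- The (upper) curvature scaling exponent
`s_j(F) = inf {t ∈ ℝ | lim_{ε ↓ 0} ε^t C_j^var(F_ε) = 0}`, as an extended real number. The parallel
set `F_ε` is `Metric.cthickening ε F`. -/
def scalingExponent {d : ℕ} (j : Fin (d + 1)) (F : Set (E d)) : EReal :=
  sInf ((fun t : ℝ => (t : EReal)) ''
    {t : ℝ | Tendsto (fun ε : ℝ => ε ^ t * curvatureVar j (Metric.cthickening ε F))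
      (𝓝[>] 0) (𝓝 0)})

/-- The average fractal curvature of index `j` of the compact set `F` exists and equals `c`: the
parallel sets `F_ε` are polyconvex for `0 < ε ≤ ε₀`, the scaling exponent `s = s_j(F)` is finite,
and the logarithmic averages of `ε^s C_j(F_ε)` over `[δ, ε₀]` are defined and tend to `c` as
`δ ↓ 0`. (The value `c` does not depend on `ε₀`.) -/
def HasAverageFractalCurvature {d : ℕ} (j : Fin (d + 1)) (F : Set (E d)) (c : ℝ) : Prop :=
  IsCompact F ∧ ∃ s : ℝ, scalingExponent j F = (s : EReal) ∧ ∃ ε₀ : ℝ, 0 < ε₀ ∧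
    (∀ ε ∈ Ioc 0 ε₀, IsPolyconvex (Metric.cthickening ε F)) ∧
    (∀ δ ∈ Ioo 0 ε₀, IntervalIntegrable
      (fun ε : ℝ => ε ^ s * totalCurvature j (Metric.cthickening ε F) / ε) volume δ ε₀) ∧
    Tendsto (fun δ : ℝ => 1 / (Real.log ε₀ - Real.log δ) *
      ∫ ε in δ..ε₀, ε ^ s * totalCurvature j (Metric.cthickening ε F) / ε) (𝓝[>] 0) (𝓝 c)

open Classical in
/-- The average fractal curvature of index `j`, with value `0` where it does not exist. -/
def averageFractalCurvature {d : ℕ} (j : Fin (d + 1)) (F : Set (E d)) : ℝ :=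
  if h : ∃ c, HasAverageFractalCurvature j F c then h.choose else 0

/-- The specific fractal curvatures of `A` are well defined: all average fractal curvatures of `A`
exist and the one of index `d` is positive. -/
def SpecificCurvatureWellDefined {d : ℕ} (A : Set (E d)) : Prop :=
  (∀ j : Fin (d + 1), ∃ c, HasAverageFractalCurvature j A c) ∧
    0 < averageFractalCurvature (Fin.last d) A

/-- The specific fractal curvature `Ξ_k(A)`, `k ∈ {0, …, d - 1}`. -/
def specificCurvature {d : ℕ} (k : Fin d) (A : Set (E d)) : ℝ :=
  averageFractalCurvature k.castSucc A / averageFractalCurvature (Fin.last d) A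

end

end FractalCurvature

/-!
Since `C_j` is homogeneous of degree `j`, the average fractal curvatures of `r • A` are those of
`A` times `r ^ (s_j + j)`. The second claim follows at once, and the first one amounts to `s_j = 0`
for every polyconvex set of positive volume.

The exponents are at most `0` because a polyconvex set and its parallel sets have uniformly bounded
curvature measures; this rests on the local Steiner formula and on the additivity of the
coefficients. They are at least `0` as soon as some piece of the boundary carries a curvature that
persists as `ε → 0`. To find one for `j < d`, fix a subspace `W` of dimension `j` and maximize, on
the slice of `A` through `z` orthogonal to `W`, the linear form given by the component `v` of `z`
in `Wᗮ`. Almost every `z ∈ A` has a maximizer `q` with a normal `u` common to all convex pieces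
through `q` such that `u` has component `v` in `Wᗮ`. Thus the components of `q` in `W` and of `u` in
`Wᗮ` recover `z`, so that the pairs `(q, u)` sweep out a set of positive volume. By the area
formula one of the countably many contact surfaces, on which a fixed subfamily of the pieces has
the common nearest point `q`, has a Steiner polynomial with nonvanishing coefficient of degree
`d - j`. All intersections within the subfamily contribute the same curvature there, so no
cancellation takes place in the inclusion-exclusion formula.
-/

namespace FractalCurvature

/-! ### Nearest points -/

/-- `y` is a point of `K` of minimal distance to `x`. -/
def IsNearest {X : Type*} [PseudoMetricSpace X] (K : Set X) (x y : X) : Prop :=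
  y ∈ K ∧ ∀ z ∈ K, dist x y ≤ dist x z

/-- A nonempty compact convex set. Points are allowed: the interior may be empty. -/
structure IsConvexBody {V : Type*} [AddCommGroup V] [Module ℝ V] [TopologicalSpace V]
    (K : Set V) : Prop where
  compact : IsCompact K
  convex : Convex ℝ K
  nonempty : K.Nonempty

section NearestPoint

variable {V : Type*} [NormedAddCommGroup V] [InnerProductSpace ℝ V] {K : Set V} {x y z : V}

/-- The nearest-point map `p_K`. Its values are meaningful where a nearest point exists, in
particular everywhere if `K` is a convex body. -/
noncomputable def nearestPoint (K : Set V) (x : V) : V :=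
  Classical.epsilon (IsNearest K x)

theorem IsNearest.inner_sub_sub_nonpos (h : IsNearest K x y) (hK : Convex ℝ K) (hz : z ∈ K) :
    inner ℝ (x - y) (z - y) ≤ 0 := by
  have hne : Nonempty K := ⟨⟨y, h.1⟩⟩
  refine (norm_eq_iInf_iff_real_inner_le_zero hK h.1).1 (le_antisymm ?_ ?_) z hz
  · exact le_ciInf fun w => by simpa [dist_eq_norm] using h.2 w w.2
  · exact ciInf_le ⟨0, by rintro _ ⟨w, rfl⟩; positivity⟩ (⟨y, h.1⟩ : K)

namespace IsConvexBody

theorem isNearest_nearestPoint (hK : IsConvexBody K) (x : V) :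
    IsNearest K x (nearestPoint K x) := by
  obtain ⟨y, hy, h⟩ := hK.compact.exists_isMinOn hK.nonempty
    (f := fun z => dist x z) (by fun_prop)
  exact Classical.epsilon_spec (p := IsNearest K x) ⟨y, hy, fun z hz => h hz⟩

theorem nearestPoint_mem (hK : IsConvexBody K) (x : V) : nearestPoint K x ∈ K :=
  (hK.isNearest_nearestPoint x).1

theorem dist_nearestPoint_le (hK : IsConvexBody K) (x : V) (hz : z ∈ K) :
    dist x (nearestPoint K x) ≤ dist x z :=
  (hK.isNearest_nearestPoint x).2 z hz

theorem inner_sub_nearestPoint_nonpos (hK : IsConvexBody K) (x : V) (hz : z ∈ K) :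
    inner ℝ (x - nearestPoint K x) (z - nearestPoint K x) ≤ 0 :=
  (hK.isNearest_nearestPoint x).inner_sub_sub_nonpos hK.convex hz

theorem nearestPoint_eq_of_inner_nonpos (hK : IsConvexBody K) (hy : y ∈ K)
    (h : ∀ z ∈ K, inner ℝ (x - y) (z - y) ≤ 0) : nearestPoint K x = y := by
  set p := nearestPoint K x
  have hpy : inner ℝ (x - y) (p - y) ≤ 0 := h p (hK.nearestPoint_mem x)
  have hyp : inner ℝ (x - p) (y - p) ≤ 0 := hK.inner_sub_nearestPoint_nonpos x hy
  have hsum : inner ℝ (p - y) (p - y) = inner ℝ (x - y) (p - y) + inner ℝ (x - p) (y - p) := by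
    simp only [inner_sub_left, inner_sub_right]
    rw [real_inner_comm y p]; ring
  have hself : inner ℝ (p - y) (p - y) ≤ 0 := by linarith
  exact sub_eq_zero.1 (real_inner_self_nonpos.1 hself)

theorem nearestPoint_eq (hK : IsConvexBody K) (h : IsNearest K x y) : nearestPoint K x = y :=
  hK.nearestPoint_eq_of_inner_nonpos h.1 fun _ hz => h.inner_sub_sub_nonpos hK.convex hz

theorem nearestPoint_of_mem (hK : IsConvexBody K) (hx : x ∈ K) : nearestPoint K x = x :=
  hK.nearestPoint_eq ⟨hx, fun z _ => by simp⟩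

theorem infDist_eq_dist_nearestPoint (hK : IsConvexBody K) (x : V) :
    Metric.infDist x K = dist x (nearestPoint K x) :=
  le_antisymm (Metric.infDist_le_dist_of_mem (hK.nearestPoint_mem x))
    ((Metric.le_infDist hK.nonempty).2 fun {_} hz => hK.dist_nearestPoint_le x hz)

theorem dist_nearestPoint_le_iff_mem_cthickening (hK : IsConvexBody K) {R : ℝ} (hR : 0 ≤ R) :
    dist x (nearestPoint K x) ≤ R ↔ x ∈ Metric.cthickening R K := by
  rw [← hK.infDist_eq_dist_nearestPoint, Metric.mem_cthickening_iff, Metric.infDist,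
    ENNReal.le_ofReal_iff_toReal_le (Metric.infEDist_ne_top hK.nonempty) hR]

theorem norm_nearestPoint_sub_sq_le_inner (hK : IsConvexBody K) (x y : V) :
    ‖nearestPoint K x - nearestPoint K y‖ ^ 2 ≤
      inner ℝ (nearestPoint K x - nearestPoint K y) (x - y) := by
  have hx := hK.inner_sub_nearestPoint_nonpos x (hK.nearestPoint_mem y)
  have hy := hK.inner_sub_nearestPoint_nonpos y (hK.nearestPoint_mem x)
  set p := nearestPoint K x
  set q := nearestPoint K y
  have hdiff : inner ℝ (p - q) (x - y) - ‖p - q‖ ^ 2 =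
      - inner ℝ (x - p) (q - p) - inner ℝ (y - q) (p - q) := by
    rw [← real_inner_self_eq_norm_sq]
    simp only [inner_sub_left, inner_sub_right]
    rw [real_inner_comm p q, real_inner_comm x p, real_inner_comm x q, real_inner_comm y p,
      real_inner_comm y q]; ring
  linarith

theorem norm_nearestPoint_sub_le (hK : IsConvexBody K) (x y : V) :
    ‖nearestPoint K x - nearestPoint K y‖ ≤ ‖x - y‖ := by
  have h := (hK.norm_nearestPoint_sub_sq_le_inner x y).trans (real_inner_le_norm _ _)
  by_contra! hlt
  nlinarith [norm_nonneg (x - y), norm_nonneg (nearestPoint K x - nearestPoint K y)]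

theorem lipschitzWith_nearestPoint (hK : IsConvexBody K) : LipschitzWith 1 (nearestPoint K) :=
  LipschitzWith.of_dist_le_mul fun x y => by
    simpa [dist_eq_norm] using hK.norm_nearestPoint_sub_le x y

theorem continuous_dist_nearestPoint (hK : IsConvexBody K) :
    Continuous fun x => dist x (nearestPoint K x) :=
  continuous_id.dist hK.lipschitzWith_nearestPoint.continuous

theorem inner_sub_norm_sq_nearestPoint_le (hK : IsConvexBody K) (a b : V) :
    inner ℝ a (nearestPoint K b) - ‖nearestPoint K b‖ ^ 2 / 2 ≤
      inner ℝ a (nearestPoint K a) - ‖nearestPoint K a‖ ^ 2 / 2 := by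
  have h := hK.dist_nearestPoint_le a (hK.nearestPoint_mem b)
  rw [dist_eq_norm, dist_eq_norm] at h
  have hsq := pow_le_pow_left₀ (norm_nonneg _) h 2
  rw [norm_sub_sq_real, norm_sub_sq_real] at hsq
  linarith

-- The nearest-point map is thus a gradient, so its differential is a symmetric operator.
theorem hasFDerivAt_inner_sub_norm_sq_nearestPoint (hK : IsConvexBody K) (x : V) :
    HasFDerivAt (fun y => inner ℝ y (nearestPoint K y) - ‖nearestPoint K y‖ ^ 2 / 2)
      (innerSL ℝ (nearestPoint K x)) x := by
  rw [hasFDerivAt_iff_isLittleO]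
  refine Asymptotics.IsBigO.trans_isLittleO (g := fun y => ‖y - x‖ ^ 2) ?_
    (Asymptotics.isLittleO_pow_sub_sub x one_lt_two)
  refine Asymptotics.IsBigO.of_bound 1 (Eventually.of_forall fun y => ?_)
  have hyx := hK.inner_sub_norm_sq_nearestPoint_le y x
  have hxy := hK.inner_sub_norm_sq_nearestPoint_le x y
  have hinner := real_inner_le_norm (nearestPoint K y - nearestPoint K x) (y - x)
  have hmul : ‖nearestPoint K y - nearestPoint K x‖ * ‖y - x‖ ≤ ‖y - x‖ ^ 2 := by
    rw [sq]; exact mul_le_mul_of_nonneg_right (hK.norm_nearestPoint_sub_le y x) (norm_nonneg _)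
  rw [Real.norm_of_nonneg (by positivity : (0 : ℝ) ≤ ‖y - x‖ ^ 2), one_mul, innerSL_apply_apply,
    Real.norm_eq_abs, abs_le]
  simp only [inner_sub_left, inner_sub_right] at *
  rw [real_inner_comm y (nearestPoint K x), real_inner_comm x (nearestPoint K x),
    real_inner_comm y (nearestPoint K y), real_inner_comm x (nearestPoint K y)] at *
  have := sq_nonneg ‖y - x‖
  constructor <;> linarith

theorem isSymmetric_of_hasFDerivAt_nearestPoint (hK : IsConvexBody K) {D : V →L[ℝ] V}
    (hD : HasFDerivAt (nearestPoint K) D x) : (D : V →ₗ[ℝ] V).IsSymmetric := by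
  intro v w
  have hgrad : HasFDerivAt (fun y => innerSL ℝ (nearestPoint K y)) ((innerSL ℝ).comp D) x :=
    (innerSL ℝ (E := V)).hasFDerivAt.comp x hD
  have hsymm := second_derivative_symmetric hK.hasFDerivAt_inner_sub_norm_sq_nearestPoint hgrad v w
  simp only [ContinuousLinearMap.comp_apply, innerSL_apply_apply] at hsymm
  simpa only [ContinuousLinearMap.coe_coe, real_inner_comm v (D w)] using hsymm

theorem norm_sq_le_inner_of_hasFDerivAt_nearestPoint (hK : IsConvexBody K) {D : V →L[ℝ] V}
    (hD : HasFDerivAt (nearestPoint K) D x) (v : V) : ‖D v‖ ^ 2 ≤ inner ℝ (D v) v := by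
  have hslope := hD.hasLineDerivAt v
  rw [HasLineDerivAt, hasDerivAt_iff_tendsto_slope_zero] at hslope
  simp only [zero_add, zero_smul, add_zero] at hslope
  refine le_of_tendsto_of_tendsto (hslope.norm.pow 2)
    (hslope.inner (𝕜 := ℝ) (tendsto_const_nhds (x := v))) ?_
  filter_upwards [self_mem_nhdsWithin] with t (ht : t ≠ 0)
  have hfirm := hK.norm_nearestPoint_sub_sq_le_inner (x + t • v) x
  rw [add_sub_cancel_left, inner_smul_right] at hfirm
  rw [norm_smul, mul_pow, inner_smul_left, norm_inv, Real.norm_eq_abs, inv_pow, sq_abs]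
  refine (mul_le_mul_of_nonneg_left hfirm (by positivity)).trans (le_of_eq ?_)
  simp only [conj_trivial]
  field_simp

theorem exists_eigenbasis_of_hasFDerivAt_nearestPoint [FiniteDimensional ℝ V]
    (hK : IsConvexBody K) {D : V →L[ℝ] V} (hD : HasFDerivAt (nearestPoint K) D x) :
    ∃ (b : OrthonormalBasis (Fin (Module.finrank ℝ V)) ℝ V) (l : Fin (Module.finrank ℝ V) → ℝ),
      (∀ i, D (b i) = l i • b i) ∧ ∀ i, l i ∈ Icc 0 1 := by
  have hsymm := hK.isSymmetric_of_hasFDerivAt_nearestPoint hD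
  have heig : ∀ i, D (hsymm.eigenvectorBasis rfl i) =
      hsymm.eigenvalues rfl i • hsymm.eigenvectorBasis rfl i :=
    fun i => hsymm.apply_eigenvectorBasis rfl i
  refine ⟨hsymm.eigenvectorBasis rfl, hsymm.eigenvalues rfl, heig, fun i => ?_⟩
  have h := hK.norm_sq_le_inner_of_hasFDerivAt_nearestPoint hD (hsymm.eigenvectorBasis rfl i)
  rw [heig, norm_smul, inner_smul_left, real_inner_self_eq_norm_sq,
    (hsymm.eigenvectorBasis rfl).norm_eq_one] at h
  simp only [mul_one, Real.norm_eq_abs, sq_abs, conj_trivial, one_pow] at h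
  constructor <;> nlinarith

end IsConvexBody

end NearestPoint

/-! ### Linear algebra and polynomials -/

section Eigenbasis

variable {𝕜 V ι : Type*} [Field 𝕜] [AddCommGroup V] [Module 𝕜 V] [Fintype ι]
  {f : V →ₗ[𝕜] V} {l : ι → 𝕜}

theorem toMatrix_eq_diagonal [DecidableEq ι] (b : Module.Basis ι 𝕜 V)
    (h : ∀ i, f (b i) = l i • b i) :
    LinearMap.toMatrix b b f = Matrix.diagonal l := by
  ext i j
  rw [LinearMap.toMatrix_apply, h, map_smul, b.repr_self, Finsupp.smul_single_one,
    Matrix.diagonal_apply, Finsupp.single_apply]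
  grind

theorem det_eq_prod_of_apply_basis (b : Module.Basis ι 𝕜 V) (h : ∀ i, f (b i) = l i • b i) :
    LinearMap.det f = ∏ i, l i := by
  classical
  rw [← LinearMap.det_toMatrix b, toMatrix_eq_diagonal b h, Matrix.det_diagonal]

theorem finrank_range_eq_card_of_apply_basis [DecidableEq 𝕜] (b : Module.Basis ι 𝕜 V)
    (h : ∀ i, f (b i) = l i • b i) :
    Module.finrank 𝕜 f.range = (Finset.univ.filter fun i => l i ≠ 0).card := by
  classical
  rw [← Fintype.card_subtype, ← Matrix.rank_diagonal, ← toMatrix_eq_diagonal b h,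
    Matrix.rank_eq_finrank_range_toLin _ b b, Matrix.toLin_toMatrix]

end Eigenbasis

section LinearFactors

open Polynomial

variable {ι R : Type*} [Fintype ι] [CommSemiring R] {u v : ι → R}

theorem natDegree_prod_C_mul_X_add_C_le (u v : ι → R) :
    (∏ i, (C (u i) * X + C (v i))).natDegree ≤ Fintype.card ι :=
  (natDegree_prod_le _ _).trans <|
    (Finset.sum_le_card_nsmul _ _ 1 fun _ _ => natDegree_linear_le).trans (by simp)

theorem coeff_prod_C_mul_X_add_C [DecidableEq ι] (u v : ι → R) (m : ℕ) :
    (∏ i, (C (u i) * X + C (v i))).coeff m =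
      ∑ t : Finset ι, if m = t.card then (∏ i ∈ t, u i) * ∏ i ∈ tᶜ, v i else 0 := by
  rw [Finset.prod_add, finsetSum_coeff, Finset.powerset_univ]
  refine Finset.sum_congr rfl fun t _ => ?_
  rw [Finset.prod_mul_distrib, Finset.prod_const, ← Finset.compl_eq_univ_sdiff,
    ← map_prod, ← map_prod, mul_right_comm, ← C_mul, coeff_C_mul_X_pow]

variable [LinearOrder R] [IsStrictOrderedRing R]

theorem ite_prod_mul_prod_compl_nonneg [DecidableEq ι] (hu : ∀ i, 0 ≤ u i)
    (hv : ∀ i, 0 ≤ v i) (m : ℕ) (t : Finset ι) :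
    0 ≤ if m = t.card then (∏ i ∈ t, u i) * ∏ i ∈ tᶜ, v i else 0 := by
  split_ifs
  · exact mul_nonneg (Finset.prod_nonneg fun i _ => hu i) (Finset.prod_nonneg fun i _ => hv i)
  · exact le_rfl

theorem coeff_prod_C_mul_X_add_C_nonneg (hu : ∀ i, 0 ≤ u i) (hv : ∀ i, 0 ≤ v i) (m : ℕ) :
    0 ≤ (∏ i, (C (u i) * X + C (v i))).coeff m := by
  classical
  rw [coeff_prod_C_mul_X_add_C]
  exact Finset.sum_nonneg fun t _ => ite_prod_mul_prod_compl_nonneg hu hv m t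

theorem coeff_prod_C_mul_X_add_C_pos (hu : ∀ i, 0 ≤ u i) (hv : ∀ i, 0 ≤ v i)
    (huv : ∀ i, v i = 0 → u i ≠ 0) {m : ℕ}
    (hm : (Finset.univ.filter fun i => v i = 0).card ≤ m)
    (hm' : m ≤ (Finset.univ.filter fun i => u i ≠ 0).card) :
    0 < (∏ i, (C (u i) * X + C (v i))).coeff m := by
  classical
  obtain ⟨t, hvt, htu, rfl⟩ := Finset.exists_subsuperset_card_eq
    (Finset.monotone_filter_right Finset.univ fun i _ => huv i) hm hm'
  rw [coeff_prod_C_mul_X_add_C]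
  refine Finset.sum_pos' (fun t _ => ite_prod_mul_prod_compl_nonneg hu hv _ t)
    ⟨t, Finset.mem_univ _, ?_⟩
  rw [if_pos rfl]
  refine mul_pos (Finset.prod_pos fun i hi => ?_) (Finset.prod_pos fun i hi => ?_)
  · exact (hu i).lt_of_ne' (Finset.mem_filter.1 (htu hi)).2
  · exact (hv i).lt_of_ne' fun h => Finset.mem_compl.1 hi (hvt (by simpa using h))

end LinearFactors

section PolynomialFamily

open Polynomial

theorem eq_of_eval_eq_of_pos {P Q : ℝ[X]} (h : ∀ ε : ℝ, 0 < ε → P.eval ε = Q.eval ε) : P = Q :=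
  eq_of_infinite_eval_eq P Q ((Ioi_infinite (0 : ℝ)).mono fun ε hε => h ε hε)

/-- The coefficient of degree `m` of the Lagrange basis polynomial that is `1` at the node `i + 1`
and `0` at the other nodes among `1, …, n + 1`. The nodes are positive because the Steiner formula
describes parallel volumes at positive distances only. -/
noncomputable def lagrangeCoeff (n m i : ℕ) : ℝ :=
  (Lagrange.basis (Finset.range (n + 1)) (fun i : ℕ => (i : ℝ) + 1) i).coeff m

theorem coeff_eq_sum_eval_mul_lagrangeCoeff {P : ℝ[X]} {n : ℕ} (hP : P.natDegree ≤ n) (m : ℕ) :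
    P.coeff m = ∑ i ∈ Finset.range (n + 1), P.eval ((i : ℝ) + 1) * lagrangeCoeff n m i := by
  have hinj : Set.InjOn (fun i : ℕ => (i : ℝ) + 1) (Finset.range (n + 1)) :=
    fun a _ b _ h => by simpa using h
  have hdeg : P.degree < (Finset.range (n + 1)).card := by
    rw [Finset.card_range]
    exact (degree_le_of_natDegree_le hP).trans_lt (by exact_mod_cast Nat.lt_succ_self n)
  conv_lhs => rw [Lagrange.eq_interpolate hinj hdeg, Lagrange.interpolate_apply]
  simp [lagrangeCoeff]

variable {Ω : Type*} [MeasurableSpace Ω] {μ : Measure Ω} {P : Ω → ℝ[X]} {n : ℕ}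

theorem integrable_coeff_of_integrable_eval (hP : ∀ x, (P x).natDegree ≤ n)
    (hint : ∀ s : ℝ, 0 < s → Integrable (fun x => (P x).eval s) μ) (m : ℕ) :
    Integrable (fun x => (P x).coeff m) μ := by
  rw [funext fun x => coeff_eq_sum_eval_mul_lagrangeCoeff (hP x) m]
  exact integrable_finsetSum _ fun i _ => (hint _ (by positivity)).mul_const _

theorem exists_polynomial_eval_eq_integral (hP : ∀ x, (P x).natDegree ≤ n)
    (hint : ∀ s : ℝ, 0 < s → Integrable (fun x => (P x).eval s) μ) :
    ∃ G : ℝ[X], G.natDegree ≤ n ∧ (∀ s, G.eval s = ∫ x, (P x).eval s ∂μ) ∧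
      ∀ m ≤ n, G.coeff m = ∫ x, (P x).coeff m ∂μ := by
  refine ⟨∑ m ∈ Finset.range (n + 1), C (∫ x, (P x).coeff m ∂μ) * X ^ m, ?_, fun s => ?_,
    fun m hm => ?_⟩
  · refine natDegree_sum_le_of_forall_le _ _ fun m hm => ?_
    exact (natDegree_C_mul_X_pow_le _ _).trans (Finset.mem_range_succ_iff.1 hm)
  · simp_rw [fun x => eval_eq_sum_range' (Nat.lt_succ_of_le (hP x)) s]
    rw [integral_finsetSum _ fun m _ =>
      (integrable_coeff_of_integrable_eval hP hint m).mul_const _]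
    simp [eval_finsetSum, integral_mul_const]
  · rw [finsetSum_coeff, Finset.sum_eq_single m (fun j _ hj => by
      rw [coeff_C_mul_X_pow, if_neg hj.symm]) (fun h => absurd (Finset.mem_range_succ_iff.2 hm) h),
      coeff_C_mul_X_pow, if_pos rfl]

theorem exists_polynomial_eval_eq_toReal_lintegral (hP : ∀ x, (P x).natDegree ≤ n)
    (hnonneg : ∀ x m, 0 ≤ (P x).coeff m)
    (hmeas : ∀ s : ℝ, AEStronglyMeasurable (fun x => (P x).eval s) μ)
    (hfin : ∀ s : ℝ, 0 < s → ∫⁻ x, ENNReal.ofReal ((P x).eval s) ∂μ < ⊤) :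
    ∃ G : ℝ[X], G.natDegree ≤ n ∧
      (∀ s : ℝ, 0 < s → G.eval s = (∫⁻ x, ENNReal.ofReal ((P x).eval s) ∂μ).toReal) ∧
      ∀ m ≤ n, μ {x | 0 < (P x).coeff m} ≠ 0 → 0 < G.coeff m := by
  have heval : ∀ s : ℝ, 0 < s → ∀ x, 0 ≤ (P x).eval s := fun s hs x => by
    rw [eval_eq_sum_range]
    exact Finset.sum_nonneg fun i _ => mul_nonneg (hnonneg x i) (by positivity)
  have hint : ∀ s : ℝ, 0 < s → Integrable (fun x => (P x).eval s) μ := fun s hs =>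
    ⟨hmeas s, (hasFiniteIntegral_iff_ofReal (Eventually.of_forall (heval s hs))).2 (hfin s hs)⟩
  obtain ⟨G, hdeg, hG, hcoeff⟩ := exists_polynomial_eval_eq_integral hP hint
  refine ⟨G, hdeg, fun s hs => ?_, fun m hm hpos => ?_⟩
  · rw [hG, integral_eq_lintegral_of_nonneg_ae (Eventually.of_forall (heval s hs)) (hmeas s)]
  · rw [hcoeff m hm, integral_pos_iff_support_of_nonneg (fun x => hnonneg x m)
      (integrable_coeff_of_integrable_eval hP hint m)]
    exact (pos_iff_ne_zero.2 hpos).trans_le (measure_mono fun x hx => ne_of_gt hx)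

end PolynomialFamily

/-! ### Shells around a convex body -/

theorem measure_image_eq_zero_of_lipschitzWith {V : Type*} [NormedAddCommGroup V]
    [NormedSpace ℝ V] [FiniteDimensional ℝ V] [MeasurableSpace V] [BorelSpace V] {μ : Measure V}
    [μ.IsAddHaarMeasure] {f : V → V} {C : NNReal} (hf : LipschitzWith C f) {s : Set V}
    (hs : μ s = 0) : μ (f '' s) = 0 := by
  have hs' : Measure.hausdorffMeasure (Module.finrank ℝ V : ℝ) s = 0 :=
    Measure.absolutelyContinuous_isAddHaarMeasure _ μ hs
  refine Measure.absolutelyContinuous_isAddHaarMeasure μ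
    (Measure.hausdorffMeasure (Module.finrank ℝ V : ℝ)) (nonpos_iff_eq_zero.1 ?_)
  simpa [hs'] using hf.hausdorffMeasure_image_le (Nat.cast_nonneg (Module.finrank ℝ V)) s

section RayScale

open Polynomial

variable {V : Type*} [NormedAddCommGroup V] [InnerProductSpace ℝ V] {K M : Set V} {x : V} {s : ℝ}

/-- The point of the ray from `p_K x` through `x` whose distance to `p_K x` is `s` times that
of `x`. -/
noncomputable def rayScale (K : Set V) (s : ℝ) (x : V) : V :=
  nearestPoint K x + s • (x - nearestPoint K x)

/-- The differential of `rayScale K s` at a point of differentiability of the nearest-point map. -/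
noncomputable def rayScaleDeriv (K : Set V) (s : ℝ) (x : V) : V →L[ℝ] V :=
  fderiv ℝ (nearestPoint K) x + s • (ContinuousLinearMap.id ℝ V - fderiv ℝ (nearestPoint K) x)

/-- `M` is invariant under sliding its points along the rays issuing from their nearest points
in `K`. -/
def IsRayInvariant (K M : Set V) : Prop :=
  ∀ x ∈ M, ∀ s : ℝ, 0 < s → rayScale K s x ∈ M

/-- The points of `M` whose distance to `K` is positive and at most `R`. -/
def shell (K M : Set V) (R : ℝ) : Set V :=
  M ∩ {x | dist x (nearestPoint K x) ∈ Ioc 0 R}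

/-- The points at which the differential of the nearest-point map has at least `k` nonzero
eigenvalues and at least `dim V - k` eigenvalues other than `1`. Through such points the shells
contribute to the curvature measure of index `k`. -/
def curvedPoints (K : Set V) (k : ℕ) : Set V :=
  {x | DifferentiableAt ℝ (nearestPoint K) x ∧
    k ≤ Module.finrank ℝ (fderiv ℝ (nearestPoint K) x).toLinearMap.range ∧
    Module.finrank ℝ V - k ≤ Module.finrank ℝ
      (ContinuousLinearMap.id ℝ V - fderiv ℝ (nearestPoint K) x).toLinearMap.range}

theorem hasFDerivAt_rayScale (h : DifferentiableAt ℝ (nearestPoint K) x) (s : ℝ) :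
    HasFDerivAt (rayScale K s) (rayScaleDeriv K s x) x :=
  h.hasFDerivAt.add (((hasFDerivAt_id x).sub h.hasFDerivAt).const_smul s)

theorem dist_rayScale_nearestPoint (x : V) (hs : 0 ≤ s) :
    dist (rayScale K s x) (nearestPoint K x) = s * dist x (nearestPoint K x) := by
  rw [rayScale, dist_eq_norm, add_sub_cancel_left, norm_smul, Real.norm_of_nonneg hs, dist_eq_norm]

namespace IsConvexBody

theorem nearestPoint_rayScale (hK : IsConvexBody K) (x : V) (hs : 0 ≤ s) :
    nearestPoint K (rayScale K s x) = nearestPoint K x := by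
  refine hK.nearestPoint_eq_of_inner_nonpos (hK.nearestPoint_mem x) fun z hz => ?_
  rw [rayScale, add_sub_cancel_left, inner_smul_left]
  exact mul_nonpos_of_nonneg_of_nonpos hs (hK.inner_sub_nearestPoint_nonpos x hz)

theorem rayScale_inv_rayScale (hK : IsConvexBody K) (x : V) (hs : 0 < s) :
    rayScale K s⁻¹ (rayScale K s x) = x := by
  rw [rayScale, hK.nearestPoint_rayScale x hs.le, rayScale, add_sub_cancel_left, smul_smul,
    inv_mul_cancel₀ hs.ne', one_smul, add_sub_cancel]

theorem rayScale_injective (hK : IsConvexBody K) (hs : 0 < s) :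
    Function.Injective (rayScale K s) :=
  Function.LeftInverse.injective fun x => hK.rayScale_inv_rayScale x hs

theorem lipschitzWith_rayScale (hK : IsConvexBody K) (s : ℝ) :
    LipschitzWith (1 + ‖s‖₊ * (1 + 1)) (rayScale K s) :=
  hK.lipschitzWith_nearestPoint.add
    ((lipschitzWith_smul s).comp (LipschitzWith.id.sub hK.lipschitzWith_nearestPoint))

theorem rayScale_mem_shell (hK : IsConvexBody K) (hM : IsRayInvariant K M) {R : ℝ} (hs : 0 < s)
    (hx : x ∈ shell K M R) : rayScale K s x ∈ shell K M (s * R) := by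
  obtain ⟨hxM, hpos, hle⟩ := hx
  refine ⟨hM x hxM s hs, ?_⟩
  rw [mem_ofPred_eq, hK.nearestPoint_rayScale x hs.le, dist_rayScale_nearestPoint x hs.le]
  exact ⟨by positivity, by gcongr⟩

theorem image_rayScale_shell (hK : IsConvexBody K) (hM : IsRayInvariant K M) {R : ℝ}
    (hs : 0 < s) : rayScale K s '' shell K M R = shell K M (s * R) := by
  refine Subset.antisymm (image_subset_iff.2 fun x => hK.rayScale_mem_shell hM hs) fun y hy => ?_
  refine ⟨rayScale K s⁻¹ y, ?_, by simpa using hK.rayScale_inv_rayScale y (inv_pos.2 hs)⟩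
  simpa [hs.ne'] using hK.rayScale_mem_shell hM (inv_pos.2 hs) hy

section

variable [FiniteDimensional ℝ V]

theorem exists_polynomial_eval_eq_det_rayScaleDeriv (hK : IsConvexBody K)
    (hx : DifferentiableAt ℝ (nearestPoint K) x) :
    ∃ P : ℝ[X], P.natDegree ≤ Module.finrank ℝ V ∧ (∀ m, 0 ≤ P.coeff m) ∧
      (∀ s : ℝ, P.eval s = (rayScaleDeriv K s x).det) ∧
      ∀ k ≤ Module.finrank ℝ V, x ∈ curvedPoints K k →
        0 < P.coeff (Module.finrank ℝ V - k) := by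
  obtain ⟨b, l, hb, hl⟩ := hK.exists_eigenbasis_of_hasFDerivAt_nearestPoint hx.hasFDerivAt
  have hl0 : ∀ i, 0 ≤ l i := fun i => (hl i).1
  have hl1 : ∀ i, 0 ≤ 1 - l i := fun i => sub_nonneg.2 (hl i).2
  have hb' : ∀ i, (ContinuousLinearMap.id ℝ V - fderiv ℝ (nearestPoint K) x) (b i) =
      (1 - l i) • b i := fun i => by
    rw [sub_apply, ContinuousLinearMap.id_apply, hb]; module
  refine ⟨∏ i, (C (1 - l i) * X + C (l i)), ?_, coeff_prod_C_mul_X_add_C_nonneg hl1 hl0,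
    fun s => ?_, fun k hk hxk => ?_⟩
  · simpa using natDegree_prod_C_mul_X_add_C_le (fun i => 1 - l i) l
  · have heig : ∀ i, rayScaleDeriv K s x (b i) = ((1 - l i) * s + l i) • b i := fun i => by
      rw [rayScaleDeriv, add_apply, smul_apply, hb, hb']
      module
    rw [ContinuousLinearMap.det, det_eq_prod_of_apply_basis b.toBasis (by simpa using heig)]
    simp [eval_prod]
  · obtain ⟨-, hrank, hrank'⟩ := hxk
    rw [finrank_range_eq_card_of_apply_basis b.toBasis (l := l) (by simpa using hb)] at hrank
    rw [finrank_range_eq_card_of_apply_basis b.toBasis (l := fun i => 1 - l i)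
      (by simpa using hb')] at hrank'
    refine coeff_prod_C_mul_X_add_C_pos hl1 hl0 (fun i hi => by simp [hi]) ?_ hrank'
    have hcard := Finset.card_filter_add_card_filter_not
      (s := (Finset.univ : Finset (Fin (Module.finrank ℝ V)))) (fun i => l i = 0)
    rw [Finset.card_univ, Fintype.card_fin] at hcard
    simp only [ne_eq] at hrank
    omega

end

variable [MeasurableSpace V]

theorem measurableSet_shell [BorelSpace V] (hK : IsConvexBody K) (hM : MeasurableSet M) (R : ℝ) :
    MeasurableSet (shell K M R) :=
  hM.inter (hK.continuous_dist_nearestPoint.measurable measurableSet_Ioc)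

variable [FiniteDimensional ℝ V] (μ : Measure V) [μ.IsAddHaarMeasure]

theorem measure_shell_lt_top (hK : IsConvexBody K) (M : Set V) (R : ℝ) : μ (shell K M R) < ⊤ := by
  refine (measure_mono (t := Metric.cthickening (max R 0) K) fun x hx => ?_).trans_lt
    (hK.compact.cthickening (r := max R 0)).measure_lt_top
  exact (hK.dist_nearestPoint_le_iff_mem_cthickening (le_max_right _ _)).1
    (hx.2.2.trans (le_max_left _ _))

variable [BorelSpace V]

theorem measurable_det_rayScaleDeriv (K : Set V) (s : ℝ) :
    Measurable fun x => (rayScaleDeriv K s x).det := by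
  have h := measurable_fderiv ℝ (nearestPoint K)
  exact ContinuousLinearMap.continuous_det.measurable.comp
    (h.add ((measurable_const.sub h).const_smul s))

theorem measure_image_rayScale_inter_differentiable (hK : IsConvexBody K) (S : Set V) :
    μ (rayScale K s '' (S ∩ {x | DifferentiableAt ℝ (nearestPoint K) x})) =
      μ (rayScale K s '' S) := by
  set D := {x | DifferentiableAt ℝ (nearestPoint K) x}
  have hnull : μ (rayScale K s '' Dᶜ) = 0 :=
    measure_image_eq_zero_of_lipschitzWith (hK.lipschitzWith_rayScale s)
      hK.lipschitzWith_nearestPoint.ae_differentiableAt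
  refine le_antisymm (measure_mono (image_mono inter_subset_left)) ?_
  calc μ (rayScale K s '' S)
      ≤ μ (rayScale K s '' (S ∩ D) ∪ rayScale K s '' Dᶜ) := by
        rw [← image_union]
        exact measure_mono (image_mono fun x hx => (em (x ∈ D)).imp (And.intro hx) id)
    _ ≤ μ (rayScale K s '' (S ∩ D)) + μ (rayScale K s '' Dᶜ) := measure_union_le _ _
    _ = μ (rayScale K s '' (S ∩ D)) := by rw [hnull, add_zero]

theorem lintegral_det_rayScaleDeriv_eq_measure_shell (hK : IsConvexBody K)
    (hMm : MeasurableSet M) (hM : IsRayInvariant K M) {R : ℝ} (hs : 0 < s) :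
    ∫⁻ x in shell K M R, ENNReal.ofReal |(rayScaleDeriv K s x).det| ∂μ =
      μ (shell K M (s * R)) := by
  set D := {x | DifferentiableAt ℝ (nearestPoint K) x}
  have hae : (shell K M R ∩ D : Set V) =ᵐ[μ] shell K M R :=
    inter_ae_eq_left_of_ae_eq_univ (ae_eq_univ.2 hK.lipschitzWith_nearestPoint.ae_differentiableAt)
  have hmeas : MeasurableSet (shell K M R ∩ D) :=
    (hK.measurableSet_shell hMm R).inter (measurableSet_of_differentiableAt ℝ (nearestPoint K))
  rw [← setLIntegral_congr hae, lintegral_abs_det_fderiv_eq_addHaar_image μ hmeas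
    (fun x hx => (hasFDerivAt_rayScale hx.2 s).hasFDerivWithinAt) (hK.rayScale_injective hs).injOn,
    hK.measure_image_rayScale_inter_differentiable μ, hK.image_rayScale_shell hM hs]

theorem exists_polynomial_eval_eq_measure_shell_mul (hK : IsConvexBody K)
    (hMm : MeasurableSet M) (hM : IsRayInvariant K M) (R : ℝ) :
    ∃ G : ℝ[X], G.natDegree ≤ Module.finrank ℝ V ∧
      (∀ s : ℝ, 0 < s → (μ (shell K M (s * R))).toReal = G.eval s) ∧
      ∀ k ≤ Module.finrank ℝ V, μ (shell K M R ∩ curvedPoints K k) ≠ 0 →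
        0 < G.coeff (Module.finrank ℝ V - k) := by
  have hex : ∀ x, ∃ P : ℝ[X], P.natDegree ≤ Module.finrank ℝ V ∧ (∀ m, 0 ≤ P.coeff m) ∧
      (DifferentiableAt ℝ (nearestPoint K) x → (∀ s : ℝ, P.eval s = (rayScaleDeriv K s x).det) ∧
        ∀ k ≤ Module.finrank ℝ V, x ∈ curvedPoints K k →
          0 < P.coeff (Module.finrank ℝ V - k)) := fun x => by
    by_cases hx : DifferentiableAt ℝ (nearestPoint K) x
    · obtain ⟨P, hdeg, hnonneg, hP⟩ := hK.exists_polynomial_eval_eq_det_rayScaleDeriv hx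
      exact ⟨P, hdeg, hnonneg, fun _ => hP⟩
    · exact ⟨0, by simp, by simp, fun h => absurd h hx⟩
  choose P hdeg hnonneg hP using hex
  have hae : ∀ s : ℝ, (fun x => (P x).eval s) =ᵐ[μ.restrict (shell K M R)]
      fun x => (rayScaleDeriv K s x).det := fun s => by
    filter_upwards [ae_restrict_of_ae hK.lipschitzWith_nearestPoint.ae_differentiableAt] with x hx
    exact (hP x hx).1 s
  have hlint : ∀ s : ℝ, 0 < s → ∫⁻ x in shell K M R, ENNReal.ofReal ((P x).eval s) ∂μ =
      μ (shell K M (s * R)) := fun s hs => by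
    rw [← hK.lintegral_det_rayScaleDeriv_eq_measure_shell μ hMm hM hs]
    refine lintegral_congr_ae ?_
    filter_upwards [hae s] with x hx
    have heval : 0 ≤ (P x).eval s := by
      rw [eval_eq_sum_range]
      exact Finset.sum_nonneg fun i _ => mul_nonneg (hnonneg x i) (by positivity)
    rw [← hx, abs_of_nonneg heval]
  obtain ⟨G, hGdeg, hG, hGcoeff⟩ := exists_polynomial_eval_eq_toReal_lintegral hdeg hnonneg
    (fun s => (measurable_det_rayScaleDeriv K s).aestronglyMeasurable.congr (hae s).symm)
    (fun s hs => (hlint s hs).trans_lt (hK.measure_shell_lt_top μ M _))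
  refine ⟨G, hGdeg, fun s hs => by rw [hG s hs, hlint s hs], fun k hk hpos => ?_⟩
  refine hGcoeff _ (Nat.sub_le _ _) fun hzero => hpos ?_
  rw [← Measure.restrict_eq_self μ inter_subset_left]
  exact measure_mono_null (fun x hx => (hP x hx.2.1).2 k hk hx.2) hzero

theorem exists_polynomial_eval_eq_measure_shell (hK : IsConvexBody K) (hMm : MeasurableSet M)
    (hM : IsRayInvariant K M) {R : ℝ} (hR : 0 < R) :
    ∃ G : ℝ[X], G.natDegree ≤ Module.finrank ℝ V ∧
      (∀ s : ℝ, 0 < s → (μ (shell K M s)).toReal = G.eval s) ∧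
      ∀ k ≤ Module.finrank ℝ V, μ (shell K M R ∩ curvedPoints K k) ≠ 0 →
        0 < G.coeff (Module.finrank ℝ V - k) := by
  obtain ⟨G, hGdeg, hG, hGcoeff⟩ := hK.exists_polynomial_eval_eq_measure_shell_mul μ hMm hM R
  refine ⟨G.comp (C R⁻¹ * X), ?_, fun s hs => ?_, fun k hk hpos => ?_⟩
  · exact natDegree_comp_le.trans ((Nat.mul_le_mul hGdeg
      ((natDegree_C_mul_le _ _).trans natDegree_X_le)).trans_eq (mul_one _))
  · rw [eval_comp, eval_mul, eval_C, eval_X, ← hG _ (by positivity)]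
    field_simp
  · rw [comp_C_mul_X_coeff]
    exact mul_pos (hGcoeff k hk hpos) (by positivity)

end IsConvexBody

end RayScale

/-! ### The local Steiner formula -/

theorem isConvexBody_or_eq_empty {V : Type*} [AddCommGroup V] [Module ℝ V] [TopologicalSpace V]
    {K : Set V} (hK : IsCompact K ∧ Convex ℝ K) : IsConvexBody K ∨ K = ∅ :=
  K.eq_empty_or_nonempty.symm.imp_left fun h => ⟨hK.1, hK.2, h⟩

theorem unitBallVolume_pos (j : ℕ) : 0 < unitBallVolume j :=
  ENNReal.toReal_pos (Metric.measure_closedBall_pos volume _ one_pos).ne'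
    (isCompact_closedBall _ _).measure_lt_top.ne

section Steiner

open Polynomial

variable {d : ℕ} {K B : Set (E d)} {P : ℝ[X]} {ε : ℝ}

theorem localParallelSet_subset_cthickening (ε : ℝ) (K B : Set (E d)) :
    localParallelSet ε K B ⊆ Metric.cthickening ε K := by
  rintro x ⟨y, ⟨hy, -⟩, -, hle⟩
  exact Metric.mem_cthickening_of_dist_le _ _ _ _ hy hle

theorem localParallelSet_eq_empty (h : K ∩ B = ∅) (ε : ℝ) : localParallelSet ε K B = ∅ := by
  simp [localParallelSet, h]

theorem volume_localParallelSet_lt_top (hK : IsCompact K) (ε : ℝ) (B : Set (E d)) :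
    volume (localParallelSet ε K B) < ⊤ :=
  (measure_mono (localParallelSet_subset_cthickening ε K B)).trans_lt
    hK.cthickening.measure_lt_top

namespace IsConvexBody

theorem localParallelSet_eq (hK : IsConvexBody K) (ε : ℝ) (B : Set (E d)) :
    localParallelSet ε K B = nearestPoint K ⁻¹' B ∩ {x | dist x (nearestPoint K x) ≤ ε} := by
  ext x
  constructor
  · rintro ⟨y, ⟨hyK, hyB⟩, hmin, hle⟩
    obtain rfl : nearestPoint K x = y := hK.nearestPoint_eq ⟨hyK, hmin⟩
    exact ⟨hyB, hle⟩
  · rintro ⟨hB, hle⟩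
    exact ⟨_, ⟨hK.nearestPoint_mem x, hB⟩, (hK.isNearest_nearestPoint x).2, hle⟩

theorem localParallelSet_eq_union_shell (hK : IsConvexBody K) (hε : 0 < ε) (B : Set (E d)) :
    localParallelSet ε K B = (K ∩ B) ∪ shell K (nearestPoint K ⁻¹' B) ε := by
  rw [hK.localParallelSet_eq]
  ext x
  constructor
  · rintro ⟨hB, hle⟩
    rcases eq_or_ne x (nearestPoint K x) with heq | hne
    · exact Or.inl ⟨heq ▸ hK.nearestPoint_mem x, by rwa [heq]⟩
    · exact Or.inr ⟨hB, dist_pos.2 hne, hle⟩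
  · rintro (⟨hxK, hxB⟩ | ⟨hB, -, hle⟩)
    · simp [hK.nearestPoint_of_mem hxK, hxB, hε.le]
    · exact ⟨hB, hle⟩

theorem disjoint_shell (hK : IsConvexBody K) (M : Set (E d)) (R : ℝ) :
    Disjoint K (shell K M R) :=
  Set.disjoint_left.2 fun x hxK hx =>
    hx.2.1.ne' (by rw [hK.nearestPoint_of_mem hxK, dist_self])

theorem isRayInvariant_preimage_nearestPoint (hK : IsConvexBody K) (B : Set (E d)) :
    IsRayInvariant K (nearestPoint K ⁻¹' B) := fun x hx s hs => by
  rwa [mem_preimage, hK.nearestPoint_rayScale x hs.le]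

end IsConvexBody

theorem measurableSet_localParallelSet (hK : IsCompact K ∧ Convex ℝ K) (ε : ℝ)
    (hB : MeasurableSet B) : MeasurableSet (localParallelSet ε K B) := by
  rcases isConvexBody_or_eq_empty hK with hK | rfl
  · rw [hK.localParallelSet_eq]
    exact (hK.lipschitzWith_nearestPoint.continuous.measurable hB).inter
      (measurableSet_le hK.continuous_dist_nearestPoint.measurable measurable_const)
  · rw [localParallelSet_eq_empty (empty_inter B)]
    exact MeasurableSet.empty

/-- `P` is the polynomial of degree at most `d` that gives the volume of the local parallel set
of `K` at `B` as a function of the distance. -/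
structure IsSteinerPolynomial (K B : Set (E d)) (P : ℝ[X]) : Prop where
  natDegree_le : P.natDegree ≤ d
  eval_eq : ∀ ε : ℝ, 0 < ε → (volume (localParallelSet ε K B)).toReal = P.eval ε

theorem isSteinerPolynomial_zero (h : K ∩ B = ∅) : IsSteinerPolynomial K B 0 :=
  ⟨by simp, fun ε _ => by simp [localParallelSet_eq_empty h]⟩

theorem exists_isSteinerPolynomial (hK : IsCompact K ∧ Convex ℝ K) (hB : MeasurableSet B) :
    ∃ P : ℝ[X], IsSteinerPolynomial K B P := by
  rcases isConvexBody_or_eq_empty hK with hK | rfl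
  · have hM : MeasurableSet (nearestPoint K ⁻¹' B) :=
      hK.lipschitzWith_nearestPoint.continuous.measurable hB
    obtain ⟨G, hdeg, hG, -⟩ := hK.exists_polynomial_eval_eq_measure_shell volume hM
      (hK.isRayInvariant_preimage_nearestPoint B) one_pos
    rw [finrank_euclideanSpace_fin] at hdeg
    refine ⟨C (volume (K ∩ B)).toReal + G, (natDegree_add_le _ _).trans (by simp [hdeg]),
      fun ε hε => ?_⟩
    rw [hK.localParallelSet_eq_union_shell hε, measure_union
      ((hK.disjoint_shell _ ε).mono_left inter_subset_left) (hK.measurableSet_shell hM ε),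
      ENNReal.toReal_add (measure_inter_lt_top_of_left_ne_top hK.compact.measure_lt_top.ne).ne
        (hK.measure_shell_lt_top volume _ _).ne, hG ε hε, eval_add, eval_C]
  · exact ⟨0, isSteinerPolynomial_zero (empty_inter B)⟩

theorem IsSteinerCoeff.eq_coeff_div {c : Fin (d + 1) → ℝ} (hc : IsSteinerCoeff K B c)
    (hP : IsSteinerPolynomial K B P) (j : Fin (d + 1)) :
    c j = P.coeff (d - j) / unitBallVolume (d - j) := by
  have hsum : P = ∑ i : Fin (d + 1), C (unitBallVolume (d - i) * c i) * X ^ (d - (i : ℕ)) := by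
    refine eq_of_eval_eq_of_pos fun ε hε => ?_
    rw [← hP.eval_eq ε hε, hc ε hε, eval_finsetSum]
    refine Finset.sum_congr rfl fun i _ => ?_
    simp only [eval_mul, eval_C, eval_pow, eval_X]
    ring
  rw [hsum, finsetSum_coeff, Finset.sum_eq_single j, coeff_C_mul_X_pow, if_pos rfl,
    mul_div_cancel_left₀ _ (unitBallVolume_pos _).ne']
  · intro i _ hij
    rw [coeff_C_mul_X_pow, if_neg]
    intro h
    exact hij (Fin.ext (by omega))
  · simp

theorem IsSteinerPolynomial.isSteinerCoeff (hP : IsSteinerPolynomial K B P) :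
    IsSteinerCoeff K B fun j => P.coeff (d - j) / unitBallVolume (d - j) := fun ε hε => by
  rw [hP.eval_eq ε hε, eval_eq_sum_range' (Nat.lt_succ_of_le hP.natDegree_le),
    ← Finset.sum_range_reflect, Finset.sum_range]
  refine Finset.sum_congr rfl fun i _ => ?_
  have hpos := unitBallVolume_pos (d - i)
  rw [show d + 1 - 1 - (i : ℕ) = d - i by omega]
  field_simp

theorem IsSteinerPolynomial.convexCurvature_eq (hP : IsSteinerPolynomial K B P)
    (j : Fin (d + 1)) : convexCurvature j K B = P.coeff (d - j) / unitBallVolume (d - j) := by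
  have h : ∃ c, IsSteinerCoeff K B c := ⟨_, hP.isSteinerCoeff⟩
  rw [convexCurvature, dif_pos h]
  exact h.choose_spec.eq_coeff_div hP j

theorem convexCurvature_eq_zero (h : K ∩ B = ∅) (j : Fin (d + 1)) : convexCurvature j K B = 0 := by
  rw [(isSteinerPolynomial_zero h).convexCurvature_eq, coeff_zero, zero_div]

theorem exists_abs_convexCurvature_le (j : Fin (d + 1)) {L : Set (E d)} (hL : IsCompact L) :
    ∃ c : ℝ, ∀ K B : Set (E d), IsCompact K ∧ Convex ℝ K → K ⊆ L → MeasurableSet B →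
      |convexCurvature j K B| ≤ c := by
  refine ⟨(∑ i ∈ Finset.range (d + 1), (volume (Metric.cthickening ((i : ℝ) + 1) L)).toReal *
    |lagrangeCoeff d (d - j) i|) / unitBallVolume (d - j), fun K B hK hKL hB => ?_⟩
  obtain ⟨P, hP⟩ := exists_isSteinerPolynomial hK hB
  rw [hP.convexCurvature_eq, abs_div, abs_of_pos (unitBallVolume_pos _),
    coeff_eq_sum_eval_mul_lagrangeCoeff hP.natDegree_le]
  refine div_le_div_of_nonneg_right ((Finset.abs_sum_le_sum_abs _ _).trans
    (Finset.sum_le_sum fun i _ => ?_)) (unitBallVolume_pos _).le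
  rw [abs_mul, ← hP.eval_eq _ (by positivity), abs_of_nonneg ENNReal.toReal_nonneg]
  gcongr
  · exact hL.cthickening.measure_lt_top.ne
  · exact (localParallelSet_subset_cthickening _ _ _).trans
      (Metric.cthickening_subset_of_subset _ hKL)

theorem sum_mul_measure_eq_zero {α ι : Type*} [MeasurableSpace α] {μ : Measure α} {s : Finset ι}
    {a : ι → ℝ} {S : ι → Set α} (hS : ∀ i ∈ s, MeasurableSet (S i)) (hfin : ∀ i ∈ s, μ (S i) < ⊤)
    (h : ∀ x, ∑ i ∈ s, (S i).indicator (fun _ => a i) x = 0) :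
    ∑ i ∈ s, a i * (μ (S i)).toReal = 0 := by
  calc ∑ i ∈ s, a i * (μ (S i)).toReal
      = ∑ i ∈ s, ∫ x, (S i).indicator (fun _ => a i) x ∂μ := by
        refine Finset.sum_congr rfl fun i hi => ?_
        rw [integral_indicator_const _ (hS i hi), smul_eq_mul, mul_comm, Measure.real]
    _ = ∫ x, ∑ i ∈ s, (S i).indicator (fun _ => a i) x ∂μ :=
        (integral_finsetSum _ fun i hi => (integrable_indicator_iff (hS i hi)).2
          (integrableOn_const (hfin i hi).ne)).symm
    _ = 0 := by simp only [h, integral_zero]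

theorem sum_mul_convexCurvature_eq_zero {ι : Type*} {s : Finset ι} {a : ι → ℝ}
    {K : ι → Set (E d)} (hK : ∀ i ∈ s, IsCompact (K i) ∧ Convex ℝ (K i)) (hB : MeasurableSet B)
    (h : ∀ ε : ℝ, 0 < ε → ∀ x,
      ∑ i ∈ s, (localParallelSet ε (K i) B).indicator (fun _ => a i) x = 0)
    (j : Fin (d + 1)) : ∑ i ∈ s, a i * convexCurvature j (K i) B = 0 := by
  choose! P hP using fun i hi => exists_isSteinerPolynomial (hK i hi) hB
  have hzero : ∑ i ∈ s, C (a i) * P i = 0 := by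
    refine eq_of_eval_eq_of_pos fun ε hε => ?_
    calc (∑ i ∈ s, C (a i) * P i).eval ε
        = ∑ i ∈ s, a i * (volume (localParallelSet ε (K i) B)).toReal := by
          rw [eval_finsetSum]
          exact Finset.sum_congr rfl fun i hi => by
            rw [eval_mul, eval_C, (hP i hi).eval_eq ε hε]
      _ = 0 := sum_mul_measure_eq_zero
          (fun i hi => measurableSet_localParallelSet (hK i hi) ε hB)
          (fun i hi => volume_localParallelSet_lt_top (hK i hi).1 ε B) (h ε hε)
      _ = (0 : ℝ[X]).eval ε := eval_zero.symm
  calc ∑ i ∈ s, a i * convexCurvature j (K i) B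
      = (∑ i ∈ s, C (a i) * P i).coeff (d - j) / unitBallVolume (d - j) := by
        rw [finsetSum_coeff, Finset.sum_div]
        exact Finset.sum_congr rfl fun i hi => by
          rw [(hP i hi).convexCurvature_eq, coeff_C_mul, mul_div_assoc]
    _ = 0 := by rw [hzero, coeff_zero, zero_div]

end Steiner

/-! ### Linear relations between indicator functions of convex sets -/

section Valuation

variable {ι G : Type*} [AddCommGroup G] {s : Finset ι} {a : ι → G}

theorem indicator_singleton_eq_sub_indicator_Icc {l u t t' : ℝ} (g : G) (hlu : l ≤ u)
    (ht : t < t') (hl : t < l → t' < l) (hu : t < u → t' < u) :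
    ({u} : Set ℝ).indicator (fun _ => g) t =
      (Icc l u).indicator (fun _ => g) t - (Icc l u).indicator (fun _ => g) t' := by
  rcases lt_trichotomy t u with htu | rfl | htu
  · by_cases htl : t < l
    · have := hl htl
      simp [htu.ne, htl.not_ge, this.not_ge]
    · simp [htu.ne, htu.le, (hu htu).le, not_lt.1 htl, (not_lt.1 htl).trans ht.le]
  · simp [hlu, ht.not_ge]
  · simp [htu.ne', htu.not_ge, (htu.trans ht).not_ge]

-- The jump from `t` to `t+` of the sum of the indicators is the sum of the `a i` with `u i = t`.
theorem sum_eq_zero_of_sum_indicator_Icc_eq_zero {l u : ι → ℝ} (hlu : ∀ i ∈ s, l i ≤ u i)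
    (h : ∀ t : ℝ, ∑ i ∈ s, (Icc (l i) (u i)).indicator (fun _ => a i) t = 0) :
    ∑ i ∈ s, a i = 0 := by
  classical
  have hfiber : ∀ t : ℝ, ∑ i ∈ s with u i = t, a i = 0 := fun t => by
    have hlt : ∀ x : ℝ, ∀ᶠ t' in 𝓝[>] t, t < x → t' < x := fun x =>
      eventually_imp_distrib_left.2 fun hx => nhdsWithin_le_nhds (eventually_lt_nhds hx)
    have hev : ∀ᶠ t' in 𝓝[>] t, ∀ i ∈ s, (t < l i → t' < l i) ∧ (t < u i → t' < u i) :=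
      (eventually_all_finset s).2 fun i _ => (hlt (l i)).and (hlt (u i))
    obtain ⟨t', ht', htt'⟩ := (hev.and self_mem_nhdsWithin).exists
    calc ∑ i ∈ s with u i = t, a i
        = ∑ i ∈ s, ((Icc (l i) (u i)).indicator (fun _ => a i) t -
            (Icc (l i) (u i)).indicator (fun _ => a i) t') := by
          rw [Finset.sum_filter]
          refine Finset.sum_congr rfl fun i hi => ?_
          rw [← indicator_singleton_eq_sub_indicator_Icc (a i) (hlu i hi) htt' (ht' i hi).1
            (ht' i hi).2, indicator_apply]
          exact if_congr eq_comm rfl rfl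
      _ = 0 := by rw [Finset.sum_sub_distrib, h, h, sub_zero]
  rw [← Finset.sum_fiberwise_of_maps_to fun i hi => Finset.mem_image_of_mem u hi]
  exact Finset.sum_eq_zero fun t _ => hfiber t

theorem sum_indicator_inter_eq_zero {α : Type*} {K : ι → Set α}
    (h : ∀ x, ∑ i ∈ s, (K i).indicator (fun _ => a i) x = 0) (C : Set α) (x : α) :
    ∑ i ∈ s, (K i ∩ C).indicator (fun _ => a i) x = 0 := by
  classical
  by_cases hx : x ∈ C
  · simpa [indicator_apply, hx] using h x
  · simp [hx]

variable {V : Type*} [NormedAddCommGroup V] [NormedSpace ℝ V] {K : ι → Set V}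

open Classical in
theorem sum_filter_nonempty_eq_zero_of_forall_level
    (hK : ∀ i ∈ s, IsCompact (K i) ∧ Convex ℝ (K i)) (f : V →L[ℝ] ℝ)
    (h : ∀ t : ℝ, ∑ i ∈ s with (K i ∩ {x | f x = t}).Nonempty, a i = 0) :
    ∑ i ∈ s with (K i).Nonempty, a i = 0 := by
  have himage : ∀ i ∈ s.filter fun i => (K i).Nonempty,
      sInf (f '' K i) ≤ sSup (f '' K i) ∧ f '' K i = Icc (sInf (f '' K i)) (sSup (f '' K i)) :=
    fun i hi => by
    obtain ⟨hi, hne⟩ := Finset.mem_filter.1 hi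
    have hcomp : IsCompact (f '' K i) := (hK i hi).1.image f.continuous
    exact ⟨csInf_le_csSup (hne.image f) hcomp.bddBelow hcomp.bddAbove, eq_Icc_of_connected_compact
      ⟨hne.image f, (hK i hi).2.isPreconnected.image f f.continuous.continuousOn⟩ hcomp⟩
  refine sum_eq_zero_of_sum_indicator_Icc_eq_zero (fun i hi => (himage i hi).1) fun t => ?_
  rw [← h t, Finset.sum_filter, Finset.sum_filter]
  refine Finset.sum_congr rfl fun i hi => ?_
  split_ifs with hne hlevel hlevel
  · obtain ⟨x, hx, rfl⟩ := hlevel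
    rw [← (himage i (Finset.mem_filter.2 ⟨hi, hne⟩)).2]
    exact indicator_of_mem (mem_image_of_mem f hx) _
  · rw [← (himage i (Finset.mem_filter.2 ⟨hi, hne⟩)).2]
    refine indicator_of_notMem ?_ _
    rintro ⟨x, hx, hxt⟩
    exact hlevel ⟨x, hx, hxt⟩
  · exact absurd (hlevel.mono inter_subset_left) hne
  · rfl

open Classical in
theorem sum_filter_nonempty_eq_zero_of_forall_levels {κ : Type*} (f : κ → V →L[ℝ] ℝ)
    (T : Finset κ) (hK : ∀ i ∈ s, IsCompact (K i) ∧ Convex ℝ (K i))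
    (h : ∀ c : κ → ℝ, ∑ i ∈ s with (K i ∩ {x | ∀ j ∈ T, f j x = c j}).Nonempty, a i = 0) :
    ∑ i ∈ s with (K i).Nonempty, a i = 0 := by
  induction T using Finset.induction_on generalizing K with
  | empty => simpa using h 0
  | insert u T hu ih =>
    refine sum_filter_nonempty_eq_zero_of_forall_level hK (f u) fun t => ?_
    refine ih (fun i hi => ⟨(hK i hi).1.inter_right (isClosed_eq (f u).continuous
      continuous_const), (hK i hi).2.inter (convex_hyperplane (f u).isLinear t)⟩) fun c => ?_
    rw [← h (Function.update c u t)]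
    refine Finset.sum_congr (Finset.filter_congr fun i _ => ?_) fun _ _ => rfl
    have hset : {x | ∀ j ∈ insert u T, f j x = Function.update c u t j} =
        {x | f u x = t} ∩ {x | ∀ j ∈ T, f j x = c j} := by
      ext x
      have hupdate : ∀ j ∈ T, Function.update c u t j = c j := fun j hj =>
        Function.update_of_ne (ne_of_mem_of_not_mem hj hu) _ _
      simp +contextual [hupdate]
    rw [hset, inter_assoc]

-- Equivalently, the Euler characteristic extends to a valuation on the convex ring.
open Classical in
theorem sum_filter_nonempty_eq_zero [FiniteDimensional ℝ V]
    (hK : ∀ i ∈ s, IsCompact (K i) ∧ Convex ℝ (K i))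
    (h : ∀ x, ∑ i ∈ s, (K i).indicator (fun _ => a i) x = 0) :
    ∑ i ∈ s with (K i).Nonempty, a i = 0 := by
  let b := Module.finBasis ℝ V
  refine sum_filter_nonempty_eq_zero_of_forall_levels
    (fun j => LinearMap.toContinuousLinearMap (b.coord j)) Finset.univ hK fun c => ?_
  have hset : {x | ∀ j ∈ Finset.univ, LinearMap.toContinuousLinearMap (b.coord j) x = c j} =
      {b.equivFun.symm c} := by
    ext x
    rw [mem_singleton_iff, LinearEquiv.eq_symm_apply]
    simp [funext_iff]
  rw [hset, ← h (b.equivFun.symm c), Finset.sum_filter]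
  simp only [inter_singleton_nonempty, indicator_apply]

theorem exists_dist_lt_of_convex {C : Set V} (hC : Convex ℝ C) {x q z : V} (hq : q ∈ C)
    (hz : z ∈ C) (hzq : dist x z < dist x q) {δ : ℝ} (hδ : 0 < δ) :
    ∃ y ∈ C, dist y q ≤ δ ∧ dist x y < dist x q := by
  have hlim : Tendsto (fun t : ℝ => AffineMap.lineMap q z t) (𝓝[>] 0) (𝓝 q) := by
    have hcont : Continuous fun t : ℝ => AffineMap.lineMap (k := ℝ) q z t :=
      AffineMap.lineMap_continuous
    simpa using (hcont.tendsto 0).mono_left nhdsWithin_le_nhds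
  obtain ⟨t, hball, ht0, ht1⟩ := ((hlim.eventually (Metric.closedBall_mem_nhds q hδ)).and
    (Ioo_mem_nhdsGT one_pos)).exists
  refine ⟨AffineMap.lineMap q z t, hC.lineMap_mem hq hz ⟨ht0.le, ht1.le⟩, hball, ?_⟩
  rw [dist_comm x, dist_comm x q] at *
  calc dist (AffineMap.lineMap q z t) x ≤ (1 - t) * dist q x + t * dist z x := by
        rw [AffineMap.lineMap_apply_module]
        exact (convexOn_dist x convex_univ).2 (mem_univ q) (mem_univ z) (sub_pos.2 ht1).le ht0.le
          (sub_add_cancel 1 t)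
    _ < dist q x := by nlinarith [dist_comm x z]

theorem exists_radii_nonempty_inter_closedBall_iff
    (hK : ∀ i ∈ s, IsClosed (K i) ∧ Convex ℝ (K i)) (x q : V) :
    ∃ δ ρ : ℝ, ∀ i ∈ s, ((K i ∩ Metric.closedBall q δ).Nonempty ↔ q ∈ K i) ∧
      ((K i ∩ Metric.closedBall q δ ∩ Metric.closedBall x ρ).Nonempty ↔
        q ∈ K i ∧ ¬ IsNearest (K i) x q) := by
  have hδ : ∀ᶠ δ in 𝓝[>] (0 : ℝ), ∀ i ∈ s, q ∉ K i → Metric.closedBall q δ ⊆ (K i)ᶜ :=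
    (eventually_all_finset s).2 fun i hi => eventually_imp_distrib_left.2 fun hq =>
      nhdsWithin_le_nhds (eventually_closedBall_subset ((hK i hi).1.isOpen_compl.mem_nhds hq))
  obtain ⟨δ, hδ, hδ0 : 0 < δ⟩ := (hδ.and self_mem_nhdsWithin).exists
  have hmem : ∀ i ∈ s, (K i ∩ Metric.closedBall q δ).Nonempty → q ∈ K i := fun i hi hne => by
    by_contra hq
    obtain ⟨y, hy, hyq⟩ := hne
    exact hδ i hi hq hyq hy
  have hρ : ∀ᶠ ρ in 𝓝[<] (dist x q), ∀ i ∈ s, q ∈ K i ∧ ¬ IsNearest (K i) x q →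
      (K i ∩ Metric.closedBall q δ ∩ Metric.closedBall x ρ).Nonempty :=
    (eventually_all_finset s).2 fun i hi => eventually_imp_distrib_left.2 fun ⟨hq, hfar⟩ => by
      obtain ⟨z, hz, hzq⟩ : ∃ z ∈ K i, dist x z < dist x q := by simpa [IsNearest, hq] using hfar
      obtain ⟨y, hy, hyq, hyx⟩ := exists_dist_lt_of_convex (hK i hi).2 hq hz hzq hδ0
      filter_upwards [nhdsWithin_le_nhds (eventually_gt_nhds hyx)] with ρ hρ
      exact ⟨y, ⟨hy, hyq⟩, Metric.mem_closedBall'.2 hρ.le⟩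
  obtain ⟨ρ, hρ, hρ0 : ρ < dist x q⟩ := (hρ.and self_mem_nhdsWithin).exists
  refine ⟨δ, ρ, fun i hi => ⟨⟨hmem i hi, fun hq => ⟨q, hq, Metric.mem_closedBall_self hδ0.le⟩⟩,
    fun hne => ⟨hmem i hi (hne.mono inter_subset_left), fun hnear => ?_⟩, hρ i hi⟩⟩
  obtain ⟨y, ⟨hy, -⟩, hyx⟩ := hne
  exact ((hnear.2 y hy).trans (Metric.mem_closedBall'.1 hyx)).not_gt hρ0

-- Small balls around `q` detect whether `q ∈ K i`; intersecting them in addition with a ball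
-- around `x` of radius slightly below `dist x q` detects whether `q` fails to be nearest to `x`.
open Classical in
theorem sum_filter_isNearest_eq_zero [FiniteDimensional ℝ V]
    (hK : ∀ i ∈ s, IsCompact (K i) ∧ Convex ℝ (K i))
    (h : ∀ x, ∑ i ∈ s, (K i).indicator (fun _ => a i) x = 0) (x q : V) :
    ∑ i ∈ s with IsNearest (K i) x q, a i = 0 := by
  obtain ⟨δ, ρ, hδρ⟩ := exists_radii_nonempty_inter_closedBall_iff
    (fun i hi => ⟨(hK i hi).1.isClosed, (hK i hi).2⟩) x q
  have hKδ : ∀ i ∈ s, IsCompact (K i ∩ Metric.closedBall q δ) ∧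
      Convex ℝ (K i ∩ Metric.closedBall q δ) := fun i hi =>
    ⟨(hK i hi).1.inter_right Metric.isClosed_closedBall, (hK i hi).2.inter (convex_closedBall _ _)⟩
  have hrel := sum_indicator_inter_eq_zero h (Metric.closedBall q δ)
  have hmem : ∑ i ∈ s with q ∈ K i, a i = 0 := by
    rw [← sum_filter_nonempty_eq_zero hKδ hrel]
    exact Finset.sum_congr (Finset.filter_congr fun i hi => (hδρ i hi).1.symm) fun _ _ => rfl
  have hfar : ∑ i ∈ s with q ∈ K i ∧ ¬ IsNearest (K i) x q, a i = 0 := by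
    rw [← sum_filter_nonempty_eq_zero (fun i hi =>
      ⟨(hKδ i hi).1.inter_right Metric.isClosed_closedBall,
        (hKδ i hi).2.inter (convex_closedBall _ _)⟩)
      (sum_indicator_inter_eq_zero hrel (Metric.closedBall x ρ))]
    exact Finset.sum_congr (Finset.filter_congr fun i hi => (hδρ i hi).2.symm) fun _ _ => rfl
  rw [← Finset.sum_filter_add_sum_filter_not _ fun i => IsNearest (K i) x q, Finset.filter_filter,
    Finset.filter_filter, hfar, add_zero] at hmem
  rw [← hmem]
  exact Finset.sum_congr (Finset.filter_congr fun i _ => ⟨fun hn => ⟨hn.1, hn⟩, And.right⟩)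
    fun _ _ => rfl

theorem sum_indicator_localParallelSet_eq_zero {d : ℕ} {K : ι → Set (E d)}
    (hK : ∀ i ∈ s, IsCompact (K i) ∧ Convex ℝ (K i))
    (h : ∀ x, ∑ i ∈ s, (K i).indicator (fun _ => a i) x = 0) (ε : ℝ) (B : Set (E d)) (x : E d) :
    ∑ i ∈ s, (localParallelSet ε (K i) B).indicator (fun _ => a i) x = 0 := by
  classical
  have hnear : ∀ i ∈ s, ∀ q, IsNearest (K i) x q → nearestPoint (K i) x = q := fun i hi q hq =>
    IsConvexBody.nearestPoint_eq ⟨(hK i hi).1, (hK i hi).2, q, hq.1⟩ hq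
  simp_rw [indicator_apply]
  rw [← Finset.sum_filter, ← Finset.sum_fiberwise_of_maps_to fun i hi =>
    Finset.mem_image_of_mem (fun i => nearestPoint (K i) x) hi]
  refine Finset.sum_eq_zero fun q hq => ?_
  rw [← sum_filter_isNearest_eq_zero hK h x q, Finset.filter_filter]
  obtain ⟨i₀, hi₀, rfl⟩ := Finset.mem_image.1 hq
  obtain ⟨hi₀, y, ⟨hyK, hyB⟩, hmin, hle⟩ := Finset.mem_filter.1 hi₀
  rw [hnear i₀ hi₀ y ⟨hyK, hmin⟩]
  refine Finset.sum_congr (Finset.filter_congr fun i hi => ⟨?_, fun hy => ?_⟩) fun _ _ => rfl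
  · rintro ⟨⟨z, ⟨hzK, -⟩, hzmin, -⟩, hzy⟩
    obtain rfl : z = y := (hnear i hi z ⟨hzK, hzmin⟩).symm.trans hzy
    exact ⟨hzK, hzmin⟩
  · exact ⟨⟨y, ⟨hy.1, hyB⟩, hy.2, hle⟩, hnear i hi y hy⟩

end Valuation

theorem sum_mul_convexCurvature_congr {d : ℕ} {ι κ : Type*} {s : Finset ι} {t : Finset κ}
    {a : ι → ℝ} {b : κ → ℝ} {K : ι → Set (E d)} {L : κ → Set (E d)}
    (hK : ∀ i ∈ s, IsCompact (K i) ∧ Convex ℝ (K i))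
    (hL : ∀ i ∈ t, IsCompact (L i) ∧ Convex ℝ (L i))
    (h : ∀ x, ∑ i ∈ s, (K i).indicator (fun _ => a i) x = ∑ i ∈ t, (L i).indicator (fun _ => b i) x)
    {B : Set (E d)} (hB : MeasurableSet B) (j : Fin (d + 1)) :
    ∑ i ∈ s, a i * convexCurvature j (K i) B = ∑ i ∈ t, b i * convexCurvature j (L i) B := by
  have hKL : ∀ i ∈ s.disjSum t, IsCompact (Sum.elim K L i) ∧ Convex ℝ (Sum.elim K L i) := by
    rintro (i | i) hi
    · exact hK i (Finset.inl_mem_disjSum.1 hi)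
    · exact hL i (Finset.inr_mem_disjSum.1 hi)
  have hrel : ∀ x, ∑ i ∈ s.disjSum t,
      (Sum.elim K L i).indicator (fun _ => Sum.elim a (-b) i) x = 0 := fun x => by
    simp [Finset.sum_disjSum, h, indicator_neg]
  have hsum := sum_mul_convexCurvature_eq_zero hKL hB
    (fun ε _ => sum_indicator_localParallelSet_eq_zero hKL hrel ε B) j
  simpa [Finset.sum_disjSum, add_neg_eq_zero] using hsum

/-! ### Inclusion-exclusion and scaling -/

section ConvexRing

variable {d m : ℕ} {F : Set (E d)} {K : Fin m → Set (E d)}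

theorem IsConvexRepr.isCompact_convex_biInter (h : IsConvexRepr F m K) {I : Finset (Fin m)}
    (hI : I.Nonempty) : IsCompact (⋂ i ∈ I, K i) ∧ Convex ℝ (⋂ i ∈ I, K i) := by
  obtain ⟨i, hi⟩ := hI
  exact ⟨(h.1 i).1.of_isClosed_subset (isClosed_biInter fun i _ => (h.1 i).1.isClosed)
    (biInter_subset_of_mem hi), convex_iInter₂ fun i _ => (h.1 i).2⟩

theorem IsConvexRepr.sum_indicator_biInter (h : IsConvexRepr F m K) (x : E d) :
    ∑ I : Finset (Fin m) with I.Nonempty,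
      (⋂ i ∈ I, K i).indicator (fun _ => (-1 : ℝ) ^ (I.card - 1)) x =
      F.indicator (fun _ => 1) x := by
  have hsum := Finset.indicator_biUnion_eq_sum_powerset Finset.univ K (fun _ => (1 : ℝ)) x
  simp only [Finset.mem_univ, iUnion_true, ← h.2, Finset.powerset_univ] at hsum
  rw [hsum]
  refine Finset.sum_congr rfl fun I hI => ?_
  obtain ⟨n, hn⟩ := Nat.exists_eq_succ_of_ne_zero (Finset.mem_filter.1 hI).2.card_ne_zero
  rw [← indicator_const_smul_apply]
  simp [hn, pow_succ]

theorem IsConvexRepr.curvature_eq (h : IsConvexRepr F m K) {B : Set (E d)}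
    (hB : MeasurableSet B) (j : Fin (d + 1)) :
    curvature j F B = ∑ I : Finset (Fin m) with I.Nonempty,
      (-1 : ℝ) ^ (I.card - 1) * convexCurvature j (⋂ i ∈ I, K i) B := by
  have hF : IsPolyconvex F := ⟨m, K, h⟩
  have h' := hF.choose_spec.choose_spec
  rw [curvature, dif_pos hF]
  refine Eq.trans ?_ (sum_mul_convexCurvature_congr
    (fun I hI => h'.isCompact_convex_biInter (Finset.mem_filter.1 hI).2)
    (fun I hI => h.isCompact_convex_biInter (Finset.mem_filter.1 hI).2)
    (fun x => (h'.sum_indicator_biInter x).trans (h.sum_indicator_biInter x).symm) hB j)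
  congr!

theorem IsConvexRepr.smul (h : IsConvexRepr F m K) (r : ℝ) :
    IsConvexRepr (r • F) m fun i => r • K i :=
  ⟨fun i => ⟨(h.1 i).1.smul r, (h.1 i).2.smul r⟩, by rw [h.2, smul_set_iUnion]⟩

theorem IsPolyconvex.smul (h : IsPolyconvex F) (r : ℝ) : IsPolyconvex (r • F) := by
  obtain ⟨m, K, hK⟩ := h
  exact ⟨m, _, hK.smul r⟩

end ConvexRing

section Scaling

open Polynomial

variable {d : ℕ} {r : ℝ} {j : Fin (d + 1)}

theorem cthickening_smul₀ {V : Type*} [NormedAddCommGroup V] [NormedSpace ℝ V] (hr : 0 < r)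
    (ε : ℝ) (A : Set V) : Metric.cthickening ε (r • A) = r • Metric.cthickening (r⁻¹ * ε) A := by
  ext x
  obtain ⟨y, rfl⟩ : ∃ y, x = r • y := ⟨r⁻¹ • x, (smul_inv_smul₀ hr.ne' x).symm⟩
  have hε : ENNReal.ofReal ε = ENNReal.ofReal r * ENNReal.ofReal (r⁻¹ * ε) := by
    rw [← ENNReal.ofReal_mul hr.le, mul_inv_cancel_left₀ hr.ne']
  rw [smul_mem_smul_set_iff₀ hr.ne', Metric.mem_cthickening_iff, Metric.mem_cthickening_iff,
    infEDist_smul₀ hr.ne', ENNReal.smul_def, smul_eq_mul, ← enorm_eq_nnnorm,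
    Real.enorm_of_nonneg hr.le, hε,
    ENNReal.mul_le_mul_iff_right (by simpa using hr) ENNReal.ofReal_ne_top]

theorem localParallelSet_smul (hr : 0 < r) (ε : ℝ) (K B : Set (E d)) :
    localParallelSet (r * ε) (r • K) (r • B) = r • localParallelSet ε K B := by
  have hdist : ∀ a b : E d, dist (r • a) (r • b) = r * dist a b := fun a b => by
    rw [dist_smul₀, Real.norm_of_nonneg hr.le]
  ext x
  obtain ⟨y, rfl⟩ : ∃ y, x = r • y := ⟨r⁻¹ • x, (smul_inv_smul₀ hr.ne' x).symm⟩
  rw [smul_mem_smul_set_iff₀ hr.ne']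
  simp only [localParallelSet, mem_ofPred_eq, ← smul_set_inter₀ hr.ne']
  simp only [← image_smul, exists_mem_image, forall_mem_image, hdist, mul_le_mul_iff_right₀ hr]

theorem IsSteinerPolynomial.smul {K B : Set (E d)} {P : ℝ[X]} (hP : IsSteinerPolynomial K B P)
    (hr : 0 < r) : IsSteinerPolynomial (r • K) (r • B) (C (r ^ d) * P.comp (C r⁻¹ * X)) where
  natDegree_le := (natDegree_C_mul_le _ _).trans (natDegree_comp_le.trans
    ((Nat.mul_le_mul hP.natDegree_le ((natDegree_C_mul_le _ _).trans natDegree_X_le)).trans_eq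
      (mul_one d)))
  eval_eq ε hε := by
    have hε' : ε = r * (r⁻¹ * ε) := by field_simp
    conv_lhs => rw [hε']
    rw [localParallelSet_smul hr, Measure.addHaar_smul_of_nonneg _ hr.le, ENNReal.toReal_mul,
      hP.eval_eq _ (by positivity), ENNReal.toReal_ofReal (by positivity)]
    simp

theorem convexCurvature_smul (hr : 0 < r) {K B : Set (E d)} (hK : IsCompact K ∧ Convex ℝ K)
    (hB : MeasurableSet B) (j : Fin (d + 1)) :
    convexCurvature j (r • K) (r • B) = r ^ (j : ℕ) * convexCurvature j K B := by
  obtain ⟨P, hP⟩ := exists_isSteinerPolynomial hK hB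
  have hpow : r ^ d * r⁻¹ ^ (d - (j : ℕ)) = r ^ (j : ℕ) := by
    rw [inv_pow, ← div_eq_mul_inv, div_eq_iff (by positivity), ← pow_add,
      Nat.add_sub_cancel' (Nat.lt_succ_iff.1 j.2)]
  rw [hP.convexCurvature_eq, (hP.smul hr).convexCurvature_eq, coeff_C_mul, comp_C_mul_X_coeff,
    ← hpow]
  ring

theorem curvature_smul (hr : 0 < r) (F : Set (E d)) {B : Set (E d)} (hB : MeasurableSet B)
    (j : Fin (d + 1)) : curvature j (r • F) (r • B) = r ^ (j : ℕ) * curvature j F B := by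
  by_cases hF : IsPolyconvex F
  · obtain ⟨m, K, hK⟩ := hF
    rw [hK.curvature_eq hB, (hK.smul r).curvature_eq (hB.const_smul₀ r), Finset.mul_sum]
    refine Finset.sum_congr rfl fun I hI => ?_
    have hinter : ⋂ i ∈ I, r • K i = r • ⋂ i ∈ I, K i := by
      ext x
      simp only [mem_iInter, mem_smul_set_iff_inv_smul_mem₀ hr.ne']
    rw [hinter, convexCurvature_smul hr (hK.isCompact_convex_biInter (Finset.mem_filter.1 hI).2) hB]
    ring
  · have hrF : ¬ IsPolyconvex (r • F) := fun h => hF (by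
      simpa only [inv_smul_smul₀ hr.ne'] using h.smul r⁻¹)
    rw [curvature, curvature, dif_neg hF, dif_neg hrF, mul_zero]

theorem totalCurvature_smul (hr : 0 < r) (F : Set (E d)) (j : Fin (d + 1)) :
    totalCurvature j (r • F) = r ^ (j : ℕ) * totalCurvature j F := by
  rw [totalCurvature, totalCurvature, ← curvature_smul hr F MeasurableSet.univ,
    smul_set_univ₀ hr.ne']

theorem curvatureVar_smul (hr : 0 < r) (F : Set (E d)) (j : Fin (d + 1)) :
    curvatureVar j (r • F) = r ^ (j : ℕ) * curvatureVar j F := by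
  have hset : {x | ∃ B, MeasurableSet B ∧ B ⊆ univ ∧ x = curvature j (r • F) B} =
      r ^ (j : ℕ) • {x | ∃ B, MeasurableSet B ∧ B ⊆ univ ∧ x = curvature j F B} := by
    ext x
    rw [mem_smul_set]
    constructor
    · rintro ⟨B, hB, -, rfl⟩
      refine ⟨_, ⟨r⁻¹ • B, hB.const_smul₀ _, subset_univ _, rfl⟩, ?_⟩
      rw [smul_eq_mul, ← curvature_smul hr F (hB.const_smul₀ _), smul_inv_smul₀ hr.ne']
    · rintro ⟨_, ⟨B, hB, -, rfl⟩, rfl⟩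
      exact ⟨r • B, hB.const_smul₀ _, subset_univ _, by rw [curvature_smul hr F hB, smul_eq_mul]⟩
  have hr' : 0 ≤ r ^ (j : ℕ) := by positivity
  rw [curvatureVar, curvatureVar, posVariation, posVariation, negVariation, negVariation, hset,
    Real.sSup_smul_of_nonneg hr', Real.sInf_smul_of_nonneg hr', smul_eq_mul, smul_eq_mul]
  ring

theorem tendsto_inv_mul_nhdsGT_zero (hr : 0 < r) :
    Tendsto (fun ε : ℝ => r⁻¹ * ε) (𝓝[>] 0) (𝓝[>] 0) := by
  refine tendsto_nhdsWithin_iff.2 ⟨?_, ?_⟩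
  · simpa using ((continuous_const_mul r⁻¹).tendsto (0 : ℝ)).mono_left nhdsWithin_le_nhds
  · filter_upwards [self_mem_nhdsWithin] with ε hε
    exact mul_pos (inv_pos.2 hr) hε

theorem tendsto_rpow_mul_curvatureVar_smul (hr : 0 < r) {A : Set (E d)} {t : ℝ}
    (h : Tendsto (fun ε : ℝ => ε ^ t * curvatureVar j (Metric.cthickening ε A)) (𝓝[>] 0) (𝓝 0)) :
    Tendsto (fun ε : ℝ => ε ^ t * curvatureVar j (Metric.cthickening ε (r • A)))
      (𝓝[>] 0) (𝓝 0) := by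
  have hscaled := (h.comp (tendsto_inv_mul_nhdsGT_zero hr)).const_mul (r ^ t * r ^ (j : ℕ))
  rw [mul_zero] at hscaled
  refine hscaled.congr' ?_
  filter_upwards [self_mem_nhdsWithin] with ε (hε : 0 < ε)
  have : r ^ t ≠ 0 := (Real.rpow_pos_of_pos hr t).ne'
  simp only [Function.comp_apply]
  rw [cthickening_smul₀ hr, curvatureVar_smul hr, Real.mul_rpow (by positivity) hε.le,
    Real.inv_rpow hr.le]
  field_simp

theorem scalingExponent_smul (hr : 0 < r) (A : Set (E d)) (j : Fin (d + 1)) :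
    scalingExponent j (r • A) = scalingExponent j A := by
  rw [scalingExponent, scalingExponent]
  congr 2
  ext t
  refine ⟨fun h => ?_, tendsto_rpow_mul_curvatureVar_smul hr⟩
  have hinv := tendsto_rpow_mul_curvatureVar_smul (inv_pos.2 hr) h
  rwa [inv_smul_smul₀ hr.ne'] at hinv

end Scaling

/-! ### Logarithmic averages -/

/-- The logarithmic averages of `f` over the intervals `[δ, ε₀]` are defined and tend to `c` as
`δ ↓ 0`; these are the averages in the definition of the average fractal curvatures. -/
def HasLogAverage (f : ℝ → ℝ) (ε₀ c : ℝ) : Prop :=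
  (∀ δ ∈ Ioo 0 ε₀, IntervalIntegrable (fun ε => f ε / ε) volume δ ε₀) ∧
    Tendsto (fun δ => 1 / (Real.log ε₀ - Real.log δ) * ∫ ε in δ..ε₀, f ε / ε) (𝓝[>] 0) (𝓝 c)

namespace HasLogAverage

variable {f g : ℝ → ℝ} {ε₀ c r : ℝ}

theorem congr (h : HasLogAverage f ε₀ c) (hε₀ : 0 < ε₀) (hfg : ∀ ε > 0, f ε = g ε) :
    HasLogAverage g ε₀ c := by
  have heqOn : ∀ δ ∈ Ioo 0 ε₀, EqOn (fun ε => f ε / ε) (fun ε => g ε / ε) (uIcc δ ε₀) :=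
    fun δ hδ ε hε => by simp only [hfg ε ((lt_min hδ.1 hε₀).trans_le hε.1)]
  refine ⟨fun δ hδ => (h.1 δ hδ).congr ((heqOn δ hδ).mono uIoc_subset_uIcc), h.2.congr' ?_⟩
  filter_upwards [Ioo_mem_nhdsGT hε₀] with δ hδ
  rw [intervalIntegral.integral_congr (heqOn δ hδ)]

theorem const_mul (h : HasLogAverage f ε₀ c) (a : ℝ) :
    HasLogAverage (fun ε => a * f ε) ε₀ (a * c) := by
  refine ⟨fun δ hδ => ?_, (h.2.const_mul a).congr fun δ => ?_⟩
  · simpa only [mul_div_assoc] using (h.1 δ hδ).const_mul a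
  · simp only [mul_div_assoc, intervalIntegral.integral_const_mul]
    ring

theorem comp_inv_mul (h : HasLogAverage f ε₀ c) (hε₀ : 0 < ε₀) (hr : 0 < r) :
    HasLogAverage (fun ε => f (r⁻¹ * ε)) (r * ε₀) c := by
  have hr' : r⁻¹ ≠ 0 := inv_ne_zero hr.ne'
  have hdiv : (fun ε => f (r⁻¹ * ε) / ε) = fun ε => r⁻¹ * (f (r⁻¹ * ε) / (r⁻¹ * ε)) := by
    funext ε
    field_simp
  refine ⟨fun δ hδ => ?_, (h.2.comp (tendsto_inv_mul_nhdsGT_zero hr)).congr' ?_⟩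
  · have hδ' : r⁻¹ * δ ∈ Ioo 0 ε₀ :=
      ⟨mul_pos (inv_pos.2 hr) hδ.1, (inv_mul_lt_iff₀ hr).2 hδ.2⟩
    have hint := (h.1 _ hδ').comp_mul_left (c := r⁻¹)
    rw [mul_div_cancel_left₀ _ hr', div_inv_eq_mul, mul_comm ε₀] at hint
    rw [hdiv]
    exact hint.const_mul _
  · filter_upwards [self_mem_nhdsWithin] with δ (hδ : 0 < δ)
    have hlog : Real.log (r * ε₀) - Real.log δ = Real.log ε₀ - Real.log (r⁻¹ * δ) := by
      rw [Real.log_mul hr.ne' hε₀.ne', Real.log_mul hr' hδ.ne', Real.log_inv]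
      ring
    rw [Function.comp_apply, hlog, hdiv, intervalIntegral.integral_const_mul,
      intervalIntegral.integral_comp_mul_left (fun ε => f ε / ε) hr', inv_mul_cancel_left₀ hr.ne',
      smul_eq_mul, inv_inv, inv_mul_cancel_left₀ hr.ne']

end HasLogAverage

theorem tendsto_const_sub_log_nhdsGT_zero (a : ℝ) :
    Tendsto (fun δ : ℝ => a - Real.log δ) (𝓝[>] 0) atTop := by
  simpa only [sub_eq_add_neg, Function.comp_apply] using tendsto_atTop_add_const_left _ a
    (tendsto_neg_atBot_atTop.comp Real.tendsto_log_nhdsGT_zero)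

theorem tendsto_const_sub_log_div_const_sub_log (a b : ℝ) :
    Tendsto (fun δ : ℝ => (a - Real.log δ) / (b - Real.log δ)) (𝓝[>] 0) (𝓝 1) := by
  have hlim : Tendsto (fun δ : ℝ => 1 + (a - b) / (b - Real.log δ)) (𝓝[>] 0) (𝓝 (1 + 0)) :=
    tendsto_const_nhds.add (tendsto_const_nhds.div_atTop (tendsto_const_sub_log_nhdsGT_zero b))
  rw [add_zero] at hlim
  refine hlim.congr' ?_
  filter_upwards [(tendsto_const_sub_log_nhdsGT_zero b).eventually_gt_atTop 0] with δ hδ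
  field_simp
  ring

theorem HasLogAverage.unique {f : ℝ → ℝ} {ε₀ ε₁ c c' : ℝ} (h : HasLogAverage f ε₀ c)
    (h' : HasLogAverage f ε₁ c') (hε₀ : 0 < ε₀) (hε₁ : 0 < ε₁) : c = c' := by
  have hconst : Tendsto (fun δ : ℝ => (∫ ε in ε₀..ε₁, f ε / ε) / (Real.log ε₁ - Real.log δ))
      (𝓝[>] 0) (𝓝 0) := tendsto_const_nhds.div_atTop (tendsto_const_sub_log_nhdsGT_zero _)
  have hlim := ((tendsto_const_sub_log_div_const_sub_log (Real.log ε₀) (Real.log ε₁)).mul h.2).add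
    hconst
  rw [one_mul, add_zero] at hlim
  refine tendsto_nhds_unique (hlim.congr' ?_) h'.2
  filter_upwards [(tendsto_const_sub_log_nhdsGT_zero (Real.log ε₁)).eventually_gt_atTop 0,
    (tendsto_const_sub_log_nhdsGT_zero (Real.log ε₀)).eventually_gt_atTop 0,
    Ioo_mem_nhdsGT hε₀, Ioo_mem_nhdsGT hε₁] with δ hlog₁ hlog₀ hδ₀ hδ₁
  rw [← intervalIntegral.integral_add_adjacent_intervals (h.1 δ hδ₀)
    ((h.1 δ hδ₀).symm.trans (h'.1 δ hδ₁))]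
  field_simp

section AverageFractalCurvature

variable {d : ℕ} {A : Set (E d)} {j : Fin (d + 1)} {c c' r : ℝ}

theorem hasAverageFractalCurvature_iff : HasAverageFractalCurvature j A c ↔ IsCompact A ∧
    ∃ s : ℝ, scalingExponent j A = s ∧ ∃ ε₀ : ℝ, 0 < ε₀ ∧
      (∀ ε ∈ Ioc 0 ε₀, IsPolyconvex (Metric.cthickening ε A)) ∧
      HasLogAverage (fun ε => ε ^ s * totalCurvature j (Metric.cthickening ε A)) ε₀ c :=
  Iff.rfl

theorem HasAverageFractalCurvature.unique (h : HasAverageFractalCurvature j A c)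
    (h' : HasAverageFractalCurvature j A c') : c = c' := by
  obtain ⟨-, s, hs, ε₀, hε₀, -, havg⟩ := hasAverageFractalCurvature_iff.1 h
  obtain ⟨-, s', hs', ε₁, hε₁, -, havg'⟩ := hasAverageFractalCurvature_iff.1 h'
  obtain rfl : s' = s := EReal.coe_injective (hs'.symm.trans hs)
  exact havg.unique havg' hε₀ hε₁

theorem HasAverageFractalCurvature.averageFractalCurvature_eq
    (h : HasAverageFractalCurvature j A c) : averageFractalCurvature j A = c := by
  have hex : ∃ c, HasAverageFractalCurvature j A c := ⟨c, h⟩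
  rw [averageFractalCurvature, dif_pos hex]
  exact hex.choose_spec.unique h

theorem HasAverageFractalCurvature.smul (hr : 0 < r) {s : ℝ}
    (h : HasAverageFractalCurvature j A c) (hs : scalingExponent j A = s) :
    HasAverageFractalCurvature j (r • A) (r ^ (s + (j : ℕ)) * c) := by
  obtain ⟨hA, s', hs', ε₀, hε₀, hpoly, havg⟩ := hasAverageFractalCurvature_iff.1 h
  obtain rfl : s' = s := EReal.coe_injective (hs'.symm.trans hs)
  refine hasAverageFractalCurvature_iff.2 ⟨hA.smul r, s', (scalingExponent_smul hr A j).trans hs,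
    r * ε₀, by positivity, fun ε hε => ?_,
    ((havg.comp_inv_mul hε₀ hr).const_mul _).congr (by positivity) fun ε hε => ?_⟩
  · rw [cthickening_smul₀ hr]
    exact (hpoly _ ⟨mul_pos (inv_pos.2 hr) hε.1, (inv_mul_le_iff₀ hr).2 hε.2⟩).smul r
  · have : r ^ s' ≠ 0 := (Real.rpow_pos_of_pos hr s').ne'
    rw [cthickening_smul₀ hr, totalCurvature_smul hr, Real.rpow_add_natCast hr.ne',
      Real.mul_rpow (by positivity) hε.le, Real.inv_rpow hr.le]
    field_simp

theorem specificCurvature_smul (hA : SpecificCurvatureWellDefined A) (hr : 0 < r)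
    {s : Fin (d + 1) → ℝ} (hs : ∀ j, scalingExponent j A = s j) (k : Fin d) :
    SpecificCurvatureWellDefined (r • A) ∧ specificCurvature k (r • A) =
      r ^ (s k.castSucc + (k : ℕ) - (s (Fin.last d) + d)) * specificCurvature k A := by
  obtain ⟨hex, hpos⟩ := hA
  have havg : ∀ j, HasAverageFractalCurvature j (r • A)
      (r ^ (s j + (j : ℕ)) * averageFractalCurvature j A) := fun j => by
    obtain ⟨c, hc⟩ := hex j
    rw [hc.averageFractalCurvature_eq]
    exact hc.smul hr (hs j)
  refine ⟨⟨fun j => ⟨_, havg j⟩, ?_⟩, ?_⟩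
  · rw [(havg _).averageFractalCurvature_eq]
    exact mul_pos (Real.rpow_pos_of_pos hr _) hpos
  · rw [specificCurvature, specificCurvature, (havg _).averageFractalCurvature_eq,
      (havg _).averageFractalCurvature_eq, Real.rpow_sub hr, mul_div_mul_comm,
      Fin.val_castSucc, Fin.val_last]

end AverageFractalCurvature

/-! ### Parallel sets of polyconvex sets -/

section Variation

variable {d : ℕ} {μ : Set (E d) → ℝ} {S B : Set (E d)} {c : ℝ}

theorem abs_le_posVariation_add_negVariation (hμ : μ ∅ = 0)
    (hc : ∀ B, MeasurableSet B → |μ B| ≤ c) (hB : MeasurableSet B) (hBS : B ⊆ S) :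
    |μ B| ≤ posVariation μ S + negVariation μ S := by
  have hup : BddAbove {x | ∃ B, MeasurableSet B ∧ B ⊆ S ∧ x = μ B} :=
    ⟨c, by rintro _ ⟨B, hB, -, rfl⟩; exact (abs_le.1 (hc B hB)).2⟩
  have hlow : BddBelow {x | ∃ B, MeasurableSet B ∧ B ⊆ S ∧ x = μ B} :=
    ⟨-c, by rintro _ ⟨B, hB, -, rfl⟩; exact (abs_le.1 (hc B hB)).1⟩
  have hpos : μ B ≤ posVariation μ S := le_csSup hup ⟨B, hB, hBS, rfl⟩
  have hneg : -μ B ≤ negVariation μ S := neg_le_neg (csInf_le hlow ⟨B, hB, hBS, rfl⟩)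
  have hpos₀ : 0 ≤ posVariation μ S := le_csSup hup ⟨∅, .empty, empty_subset S, hμ.symm⟩
  have hneg₀ : 0 ≤ negVariation μ S :=
    neg_nonneg.2 (csInf_le hlow ⟨∅, .empty, empty_subset S, hμ.symm⟩)
  exact abs_le.2 ⟨by linarith, by linarith⟩

theorem posVariation_add_negVariation_le (hc : ∀ B, MeasurableSet B → |μ B| ≤ c) :
    posVariation μ S + negVariation μ S ≤ 2 * c := by
  have hne : {x | ∃ B, MeasurableSet B ∧ B ⊆ S ∧ x = μ B}.Nonempty :=
    ⟨_, ∅, .empty, empty_subset S, rfl⟩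
  have hpos : posVariation μ S ≤ c :=
    csSup_le hne (by rintro _ ⟨B, hB, -, rfl⟩; exact (abs_le.1 (hc B hB)).2)
  have hneg : negVariation μ S ≤ c :=
    neg_le.1 (le_csInf hne (by rintro _ ⟨B, hB, -, rfl⟩; exact (abs_le.1 (hc B hB)).1))
  linarith

end Variation

theorem cthickening_iUnion_of_finite {α ι : Type*} [PseudoEMetricSpace α] [Finite ι]
    (δ : ℝ) (K : ι → Set α) :
    Metric.cthickening δ (⋃ i, K i) = ⋃ i, Metric.cthickening δ (K i) := by
  ext x
  simp only [mem_iUnion, Metric.mem_cthickening_iff, Metric.infEDist_iUnion]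
  refine ⟨fun h => ?_, fun ⟨i, hi⟩ => (iInf_le _ i).trans hi⟩
  rcases isEmpty_or_nonempty ι with hι | hι
  · simp [iInf_of_empty] at h
  · obtain ⟨i, hi⟩ := exists_eq_ciInf_of_finite (f := fun i => Metric.infEDist x (K i))
    exact ⟨i, hi.trans_le h⟩

section ConvexRing

variable {d m : ℕ} {A : Set (E d)} {K : Fin m → Set (E d)} {j : Fin (d + 1)}

theorem IsConvexRepr.cthickening (h : IsConvexRepr A m K) (ε : ℝ) :
    IsConvexRepr (Metric.cthickening ε A) m fun i => Metric.cthickening ε (K i) :=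
  ⟨fun i => ⟨(h.1 i).1.cthickening, (h.1 i).2.cthickening ε⟩, by
    rw [h.2, cthickening_iUnion_of_finite]⟩

theorem IsConvexRepr.isCompact (h : IsConvexRepr A m K) : IsCompact A := by
  rw [h.2]
  exact isCompact_iUnion fun i => (h.1 i).1

theorem IsConvexRepr.exists_forall_abs_curvature_cthickening_le (h : IsConvexRepr A m K)
    (j : Fin (d + 1)) :
    ∃ c : ℝ, ∀ ε ≤ 1, ∀ B, MeasurableSet B → |curvature j (Metric.cthickening ε A) B| ≤ c := by
  obtain ⟨c, hc⟩ := exists_abs_convexCurvature_le j (h.isCompact.cthickening (r := 1))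
  refine ⟨∑ I : Finset (Fin m) with I.Nonempty, c, fun ε hε B hB => ?_⟩
  rw [(h.cthickening ε).curvature_eq hB]
  refine (Finset.abs_sum_le_sum_abs _ _).trans (Finset.sum_le_sum fun I hI => ?_)
  rw [abs_mul, abs_pow, abs_neg, abs_one, one_pow, one_mul]
  have hI' := (Finset.mem_filter.1 hI).2
  refine hc _ _ ((h.cthickening ε).isCompact_convex_biInter hI') ?_ hB
  obtain ⟨i, hi⟩ := hI'
  refine (biInter_subset_of_mem hi).trans ((Metric.cthickening_mono hε _).trans ?_)
  rw [h.2]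
  exact Metric.cthickening_subset_of_subset _ (subset_iUnion K i)

theorem curvature_empty (j : Fin (d + 1)) (F : Set (E d)) : curvature j F ∅ = 0 := by
  rw [curvature]
  split_ifs
  · exact Finset.sum_eq_zero fun I _ => by rw [convexCurvature_eq_zero (inter_empty _), mul_zero]
  · rfl

theorem IsConvexRepr.abs_curvature_cthickening_le_curvatureVar (h : IsConvexRepr A m K) {ε : ℝ}
    (hε : ε ≤ 1) {B : Set (E d)} (hB : MeasurableSet B) :
    |curvature j (Metric.cthickening ε A) B| ≤ curvatureVar j (Metric.cthickening ε A) := by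
  obtain ⟨c, hc⟩ := h.exists_forall_abs_curvature_cthickening_le j
  exact abs_le_posVariation_add_negVariation (curvature_empty j _) (hc ε hε) hB (subset_univ B)

end ConvexRing

theorem tendsto_rpow_nhdsGT_zero {t : ℝ} (ht : 0 < t) :
    Tendsto (fun ε : ℝ => ε ^ t) (𝓝[>] 0) (𝓝 0) := by
  simpa only [Real.zero_rpow ht.ne'] using
    (Real.continuousAt_rpow_const 0 t (Or.inr ht.le)).tendsto.mono_left nhdsWithin_le_nhds

theorem scalingExponent_le_zero {d : ℕ} {F : Set (E d)} {j : Fin (d + 1)}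
    (h : IsBoundedUnder (· ≤ ·) (𝓝[>] 0) fun ε => |curvatureVar j (Metric.cthickening ε F)|) :
    scalingExponent j F ≤ 0 := by
  refine le_of_forall_gt_imp_ge_of_dense fun y hy => ?_
  obtain ⟨t, ht, hty⟩ := EReal.lt_iff_exists_real_btwn.1 hy
  refine (sInf_le (mem_image_of_mem _ ?_)).trans hty.le
  exact (tendsto_rpow_nhdsGT_zero (EReal.coe_pos.1 ht)).zero_mul_isBoundedUnder_le h

theorem scalingExponent_nonneg {d : ℕ} {F : Set (E d)} {j : Fin (d + 1)}
    (h : ¬ Tendsto (fun ε => curvatureVar j (Metric.cthickening ε F)) (𝓝[>] 0) (𝓝 0)) :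
    0 ≤ scalingExponent j F := by
  refine le_sInf ?_
  rintro _ ⟨t, ht, rfl⟩
  rw [EReal.coe_nonneg]
  by_contra! hneg
  have hlim := (tendsto_rpow_nhdsGT_zero (neg_pos.2 hneg)).mul ht
  rw [mul_zero] at hlim
  refine h (hlim.congr' ?_)
  filter_upwards [self_mem_nhdsWithin] with ε (hε : 0 < ε)
  rw [← mul_assoc, ← Real.rpow_add hε, neg_add_cancel, Real.rpow_zero, one_mul]

section ConvexRing

variable {d m : ℕ} {A : Set (E d)} {K : Fin m → Set (E d)} {j : Fin (d + 1)}

theorem IsConvexRepr.isBoundedUnder_curvatureVar_cthickening (h : IsConvexRepr A m K) :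
    IsBoundedUnder (· ≤ ·) (𝓝[>] 0) fun ε => |curvatureVar j (Metric.cthickening ε A)| := by
  obtain ⟨c, hc⟩ := h.exists_forall_abs_curvature_cthickening_le j
  refine isBoundedUnder_of_eventually_le (a := 2 * c) ?_
  filter_upwards [Ioo_mem_nhdsGT (zero_lt_one' ℝ)] with ε hε
  rw [abs_of_nonneg ((abs_nonneg _).trans
    (h.abs_curvature_cthickening_le_curvatureVar hε.2.le MeasurableSet.empty))]
  exact posVariation_add_negVariation_le (hc ε hε.2.le)

theorem IsConvexRepr.scalingExponent_eq_zero_of_tendsto (h : IsConvexRepr A m K)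
    {f : ℝ → ℝ} {v : ℝ} (hv : 0 < v) (hf : Tendsto f (𝓝[>] 0) (𝓝 v))
    (hle : ∀ᶠ ε in 𝓝[>] 0, f ε ≤ curvatureVar j (Metric.cthickening ε A)) :
    scalingExponent j A = 0 :=
  le_antisymm (scalingExponent_le_zero h.isBoundedUnder_curvatureVar_cthickening)
    (scalingExponent_nonneg fun hlim => hv.not_ge (le_of_tendsto_of_tendsto hf hlim hle))

theorem unitBallVolume_zero : unitBallVolume 0 = 1 := by
  rw [unitBallVolume, volume_euclideanSpace_eq_dirac]
  simp

theorem tendsto_toReal_volume_localParallelSet_univ {K : Set (E d)}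
    (hK : IsCompact K ∧ Convex ℝ K) :
    Tendsto (fun ε => (volume (localParallelSet ε K univ)).toReal) (𝓝[>] 0)
      (𝓝 (volume K).toReal) := by
  rcases isConvexBody_or_eq_empty hK with hbody | rfl
  · refine ((ENNReal.tendsto_toReal hK.1.measure_lt_top.ne).comp
      ((tendsto_measure_cthickening_of_isCompact hK.1).mono_left nhdsWithin_le_nhds)).congr' ?_
    filter_upwards [self_mem_nhdsWithin] with ε (hε : 0 < ε)
    rw [Function.comp_apply]
    congr 2
    ext x
    simp [hbody.localParallelSet_eq, hbody.dist_nearestPoint_le_iff_mem_cthickening hε.le]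
  · simp [localParallelSet_eq_empty]

theorem convexCurvature_last {K : Set (E d)} (hK : IsCompact K ∧ Convex ℝ K) :
    convexCurvature (Fin.last d) K univ = (volume K).toReal := by
  obtain ⟨P, hP⟩ := exists_isSteinerPolynomial hK MeasurableSet.univ
  have hlim : Tendsto (fun ε : ℝ => P.eval ε) (𝓝[>] 0) (𝓝 (P.eval 0)) :=
    (P.continuous.tendsto 0).mono_left nhdsWithin_le_nhds
  rw [hP.convexCurvature_eq, Fin.val_last, Nat.sub_self, unitBallVolume_zero, div_one,
    Polynomial.coeff_zero_eq_eval_zero]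
  refine tendsto_nhds_unique (hlim.congr' ?_) (tendsto_toReal_volume_localParallelSet_univ hK)
  filter_upwards [self_mem_nhdsWithin] with ε (hε : 0 < ε)
  rw [hP.eval_eq ε hε]

theorem IsConvexRepr.curvature_last (h : IsConvexRepr A m K) :
    curvature (Fin.last d) A univ = volume.real A := by
  have hsum := measureReal_biUnion_eq_sum_powerset (μ := volume) (t := Finset.univ) (s := K)
    (fun i _ => (h.1 i).1.measurableSet) (fun i _ => (h.1 i).1.measure_lt_top.ne)
  simp only [Finset.mem_univ, iUnion_true, ← h.2, Finset.powerset_univ] at hsum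
  rw [h.curvature_eq MeasurableSet.univ, hsum]
  refine Finset.sum_congr rfl fun I hI => ?_
  have hI' := (Finset.mem_filter.1 hI).2
  obtain ⟨n, hn⟩ := Nat.exists_eq_succ_of_ne_zero hI'.card_ne_zero
  rw [convexCurvature_last (h.isCompact_convex_biInter hI'), hn, Measure.real]
  simp [pow_succ]

theorem IsConvexRepr.scalingExponent_last (h : IsConvexRepr A m K) (hA : 0 < volume A) :
    scalingExponent (Fin.last d) A = 0 := by
  refine h.scalingExponent_eq_zero_of_tendsto
    (ENNReal.toReal_pos hA.ne' h.isCompact.measure_lt_top.ne) tendsto_const_nhds ?_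
  filter_upwards [Ioo_mem_nhdsGT (zero_lt_one' ℝ)] with ε hε
  calc volume.real A ≤ volume.real (Metric.cthickening ε A) :=
        measureReal_mono (Metric.self_subset_cthickening A)
          h.isCompact.cthickening.measure_lt_top.ne
    _ = curvature (Fin.last d) (Metric.cthickening ε A) univ :=
        (h.cthickening ε).curvature_last.symm
    _ ≤ curvatureVar (Fin.last d) (Metric.cthickening ε A) := (le_abs_self _).trans
        (h.abs_curvature_cthickening_le_curvatureVar hε.2.le MeasurableSet.univ)

end ConvexRing

/-! ### Curvature at contact surfaces -/

section ClosedShell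

variable {V : Type*} [NormedAddCommGroup V] {K M : Set V} {a b : ℝ}

/-- The points of `M` whose distance to `K` lies in `[a, b]`; for `a = b` this is the part of the
boundary of a parallel set of `K` that lies in `M`. -/
def closedShell (K M : Set V) (a b : ℝ) : Set V :=
  M ∩ {x | dist x (nearestPoint K x) ∈ Icc a b}

theorem shell_union_closedShell (ha : 0 < a) (hab : a ≤ b) :
    shell K M a ∪ closedShell K M a b = shell K M b := by
  rw [shell, closedShell, ← inter_union_distrib_left, shell, ← Ioc_union_Icc_eq_Ioc ha hab]
  rfl

theorem shell_inter_closedShell (ha : 0 < a) (hab : a ≤ b) :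
    shell K M a ∩ closedShell K M a b = closedShell K M a a := by
  ext x
  simp only [shell, closedShell, mem_inter_iff, mem_ofPred_eq, mem_Ioc, mem_Icc]
  constructor
  · rintro ⟨⟨hM, -, hle⟩, -, hge, -⟩
    exact ⟨hM, hge, hle⟩
  · rintro ⟨hM, hge, hle⟩
    exact ⟨⟨hM, ha.trans_le hge, hle⟩, hM, hge, hle.trans hab⟩

variable [InnerProductSpace ℝ V] [MeasurableSpace V] [BorelSpace V]

theorem IsConvexBody.measurableSet_closedShell (hK : IsConvexBody K) (hM : MeasurableSet M)
    (a b : ℝ) : MeasurableSet (closedShell K M a b) :=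
  hM.inter (hK.continuous_dist_nearestPoint.measurable measurableSet_Icc)

theorem IsConvexBody.toReal_measure_closedShell [FiniteDimensional ℝ V] (μ : Measure V)
    [μ.IsAddHaarMeasure] (hK : IsConvexBody K) (hM : MeasurableSet M) (ha : 0 < a) (hab : a ≤ b) :
    (μ (closedShell K M a b)).toReal =
      (μ (shell K M b)).toReal + (μ (closedShell K M a a)).toReal - (μ (shell K M a)).toReal := by
  have hfin : ∀ c, a ≤ c → μ (closedShell K M a c) ≠ ⊤ := fun c hc =>
    measure_ne_top_of_subset (shell_union_closedShell (K := K) (M := M) ha hc ▸ subset_union_right)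
      (hK.measure_shell_lt_top μ M c).ne
  have hsum := measure_union_add_inter (μ := μ) (shell K M a)
    (hK.measurableSet_closedShell hM a b)
  rw [shell_union_closedShell ha hab, shell_inter_closedShell ha hab] at hsum
  have hsum_toReal := congrArg ENNReal.toReal hsum
  rw [ENNReal.toReal_add (hK.measure_shell_lt_top μ M b).ne (hfin a le_rfl),
    ENNReal.toReal_add (hK.measure_shell_lt_top μ M a).ne (hfin b hab)] at hsum_toReal
  linarith

end ClosedShell

theorem eq_add_smul_of_isNearest_closedBall {V : Type*} [NormedAddCommGroup V]
    [InnerProductSpace ℝ V] {q x y : V} {ε : ℝ} (hε : 0 < ε)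
    (h : IsNearest (Metric.closedBall q ε) x y) (hy : dist y q = ε) :
    x = q + (1 + dist x y / ε) • (y - q) := by
  rw [dist_eq_norm] at hy
  suffices hxy : x - y = (‖x - y‖ / ε) • (y - q) by
    rw [add_smul, one_smul, dist_eq_norm, ← hxy]
    abel
  rcases eq_or_ne (x - y) 0 with hzero | hne
  · simp [hzero]
  have hnorm : 0 < ‖x - y‖ := norm_pos_iff.2 hne
  have hinner := h.inner_sub_sub_nonpos (convex_closedBall q ε)
    (z := q + (ε / ‖x - y‖) • (x - y)) (by
      rw [Metric.mem_closedBall, dist_eq_norm, add_sub_cancel_left, norm_smul,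
        Real.norm_of_nonneg (by positivity), div_mul_cancel₀ _ hnorm.ne'])
  have hsplit : q + (ε / ‖x - y‖) • (x - y) - y = (ε / ‖x - y‖) • (x - y) - (y - q) := by abel
  have hmul : ε / ‖x - y‖ * ‖x - y‖ ^ 2 = ‖x - y‖ * ‖y - q‖ := by
    rw [hy]
    field_simp
  rw [hsplit, inner_sub_right, inner_smul_right, real_inner_self_eq_norm_sq, hmul] at hinner
  have hparallel := inner_eq_norm_mul_iff_real.1
    (le_antisymm (real_inner_le_norm (x - y) (y - q)) (by linarith))
  rw [hy] at hparallel
  rw [div_eq_inv_mul, mul_smul, ← hparallel, inv_smul_smul₀ hε.ne']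

section ContactSet

variable {V ι : Type*} [NormedAddCommGroup V] {K : ι → Set V} {J : Finset ι} {j₀ : ι} {ρ : ℝ}

/-- The points that have the same nearest point in all sets `K j`, `j ∈ J`, at distance more than
`ρ` from the remaining sets. The nearest point is written as that in `K j₀`, where `j₀ ∈ J`. -/
def contactSet (K : ι → Set V) (J : Finset ι) (j₀ : ι) (ρ : ℝ) : Set V :=
  {x | (∀ j ∈ J, nearestPoint (K j) x = nearestPoint (K j₀) x) ∧
    ∀ j ∉ J, ENNReal.ofReal ρ < Metric.infEDist (nearestPoint (K j₀) x) (K j)}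

theorem mem_of_mem_closedShell_contactSet {ε : ℝ} (hε : 0 ≤ ε) (hρ : 2 * ε ≤ ρ) {y : V}
    (hy : y ∈ closedShell (K j₀) (contactSet K J j₀ ρ) ε ε) {i : ι}
    (hi : y ∈ Metric.cthickening ε (K i)) : i ∈ J := by
  by_contra hiJ
  refine (hy.1.2 i hiJ).not_ge ?_
  calc Metric.infEDist (nearestPoint (K j₀) y) (K i)
      ≤ Metric.infEDist y (K i) + edist (nearestPoint (K j₀) y) y :=
        Metric.infEDist_le_infEDist_add_edist
    _ ≤ ENNReal.ofReal ε + ENNReal.ofReal ε := by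
        rw [edist_comm, edist_dist]
        exact add_le_add (Metric.mem_cthickening_iff.1 hi) (ENNReal.ofReal_le_ofReal hy.2.2)
    _ ≤ ENNReal.ofReal ρ := by
        rw [← ENNReal.ofReal_add hε hε, ← two_mul]
        exact ENNReal.ofReal_le_ofReal hρ

variable [InnerProductSpace ℝ V]

theorem nearestPoint_mem_of_mem_contactSet (hJ : ∀ j ∈ J, IsConvexBody (K j)) {x : V}
    (hx : x ∈ contactSet K J j₀ ρ) {j : ι} (hj : j ∈ J) : nearestPoint (K j₀) x ∈ K j :=
  hx.1 j hj ▸ (hJ j hj).nearestPoint_mem x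

theorem measurableSet_contactSet [MeasurableSpace V] [BorelSpace V] [SecondCountableTopology V]
    [Finite ι] (hJ : ∀ j ∈ J, IsConvexBody (K j)) (hj₀ : j₀ ∈ J) :
    MeasurableSet (contactSet K J j₀ ρ) := by
  have hmeas : ∀ j ∈ J, Measurable (nearestPoint (K j)) := fun j hj =>
    (hJ j hj).lipschitzWith_nearestPoint.continuous.measurable
  have hinter : contactSet K J j₀ ρ = (⋂ j ∈ J, {x | nearestPoint (K j) x = nearestPoint (K j₀) x})
      ∩ ⋂ j ∈ (J : Set ι)ᶜ,
        {x | ENNReal.ofReal ρ < Metric.infEDist (nearestPoint (K j₀) x) (K j)} := by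
    ext x
    simp [contactSet]
  rw [hinter]
  exact (Finset.measurableSet_biInter _ fun j hj =>
      measurableSet_eq_fun (hmeas j hj) (hmeas j₀ hj₀)).inter
    (.biInter (to_countable _) fun j _ => measurableSet_lt measurable_const
      (Metric.continuous_infEDist.measurable.comp (hmeas j₀ hj₀)))

theorem isRayInvariant_contactSet (hJ : ∀ j ∈ J, IsConvexBody (K j)) (hj₀ : j₀ ∈ J) :
    IsRayInvariant (K j₀) (contactSet K J j₀ ρ) := by
  intro x hx s hs
  have hnearest₀ := (hJ j₀ hj₀).nearestPoint_rayScale x hs.le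
  refine ⟨fun j hj => ?_, fun j hj => ?_⟩
  · rw [hnearest₀, rayScale, ← hx.1 j hj]
    exact (hJ j hj).nearestPoint_rayScale x hs.le
  · rw [hnearest₀]
    exact hx.2 j hj

end ContactSet

section Curvature

open Polynomial

variable {d m : ℕ} {A : Set (E d)} {K : Fin m → Set (E d)} {J I : Finset (Fin m)} {j₀ : Fin m}
  {ρ ε η : ℝ}

-- The ball of radius `ε` about the common nearest point lies in all the parallel sets, so normals
-- of their intersection are normals of this ball.
theorem localParallelSet_closedShell_contactSet_subset (hJ : ∀ j ∈ J, IsConvexBody (K j))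
    (hj₀ : j₀ ∈ J) (hε : 0 < ε) (hIJ : I ⊆ J) :
    localParallelSet η (⋂ i ∈ I, Metric.cthickening ε (K i))
        (closedShell (K j₀) (contactSet K J j₀ ρ) ε ε) ⊆
      closedShell (K j₀) (contactSet K J j₀ ρ) ε (ε + η) := by
  rintro x ⟨y, ⟨-, hyM, hyε⟩, hmin, hη⟩
  rw [mem_ofPred_eq, Icc_self, mem_singleton_iff] at hyε
  have hball : Metric.closedBall (nearestPoint (K j₀) y) ε ⊆
      ⋂ i ∈ I, Metric.cthickening ε (K i) := fun z hz => mem_iInter₂.2 fun i hi =>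
    Metric.mem_cthickening_of_dist_le _ _ _ _
      (nearestPoint_mem_of_mem_contactSet hJ hyM (hIJ hi)) hz
  have hx : x = rayScale (K j₀) (1 + dist x y / ε) y :=
    eq_add_smul_of_isNearest_closedBall hε ⟨hyε.le, fun z hz => hmin z (hball hz)⟩ hyε
  have hscale : 0 < 1 + dist x y / ε := by positivity
  have hdist : dist x (nearestPoint (K j₀) x) = ε + dist x y := by
    have hray := dist_rayScale_nearestPoint (K := K j₀) y hscale.le
    rw [hyε, ← (hJ j₀ hj₀).nearestPoint_rayScale y hscale.le, ← hx] at hray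
    rw [hray]
    field_simp
  refine ⟨hx ▸ isRayInvariant_contactSet hJ hj₀ y hyM _ hscale, ?_⟩
  rw [mem_ofPred_eq, hdist]
  exact ⟨le_add_of_nonneg_right dist_nonneg, by gcongr⟩

theorem closedShell_contactSet_subset_localParallelSet (hJ : ∀ j ∈ J, IsConvexBody (K j))
    (hj₀ : j₀ ∈ J) (hε : 0 < ε) (hIJ : I ⊆ J) (hI : I.Nonempty) :
    closedShell (K j₀) (contactSet K J j₀ ρ) ε (ε + η) ⊆
      localParallelSet η (⋂ i ∈ I, Metric.cthickening ε (K i))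
        (closedShell (K j₀) (contactSet K J j₀ ρ) ε ε) := by
  rintro x ⟨hxM, hge, hle⟩
  have hpos : 0 < dist x (nearestPoint (K j₀) x) := hε.trans_le hge
  have hscale : 0 < ε / dist x (nearestPoint (K j₀) x) := by positivity
  set y := rayScale (K j₀) (ε / dist x (nearestPoint (K j₀) x)) x
  have hyx : nearestPoint (K j₀) y = nearestPoint (K j₀) x :=
    (hJ j₀ hj₀).nearestPoint_rayScale x hscale.le
  have hyε : dist y (nearestPoint (K j₀) x) = ε := by
    rw [dist_rayScale_nearestPoint x hscale.le, div_mul_cancel₀ _ hpos.ne']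
  have hxy : dist x y = dist x (nearestPoint (K j₀) x) - ε := by
    have hsub : x - y = (1 - ε / dist x (nearestPoint (K j₀) x)) •
        (x - nearestPoint (K j₀) x) := by
      simp only [y, rayScale]
      module
    rw [dist_eq_norm, hsub, norm_smul, Real.norm_of_nonneg
      (sub_nonneg.2 ((div_le_one hpos).2 hge)), ← dist_eq_norm, sub_mul, one_mul,
      div_mul_cancel₀ _ hpos.ne']
  refine ⟨y, ⟨mem_iInter₂.2 fun i hi => ?_, isRayInvariant_contactSet hJ hj₀ x hxM _ hscale, ?_⟩,
    fun z hz => ?_, by linarith⟩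
  · exact Metric.mem_cthickening_of_dist_le _ _ _ _
      (nearestPoint_mem_of_mem_contactSet hJ hxM (hIJ hi)) hyε.le
  · rw [mem_ofPred_eq, hyx, hyε, Icc_self, mem_singleton_iff]
  · obtain ⟨i, hi⟩ := hI
    have hbody := hJ i (hIJ hi)
    have hz' := (hbody.dist_nearestPoint_le_iff_mem_cthickening hε.le).2 (mem_iInter₂.1 hz i hi)
    have hx' := hbody.dist_nearestPoint_le x (hbody.nearestPoint_mem z)
    rw [hxM.1 i (hIJ hi)] at hx'
    linarith [dist_triangle x z (nearestPoint (K i) z)]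

theorem sum_neg_one_pow_card_sub_one_mul_ite_subset {ι R : Type*} [Fintype ι] [DecidableEq ι]
    [CommRing R] {J : Finset ι} (hJ : J.Nonempty) (v : R) :
    ∑ I : Finset ι with I.Nonempty, (-1) ^ (I.card - 1) * (if I ⊆ J then v else 0) = v := by
  have hterm : ∀ I : Finset ι, (if I.Nonempty then
      (-1) ^ (I.card - 1) * (if I ⊆ J then v else 0) else 0) =
      (if I = ∅ then v else 0) - if I ⊆ J then (-1) ^ I.card * v else 0 := fun I => by
    rcases I.eq_empty_or_nonempty with rfl | hI
    · simp
    · obtain ⟨n, hn⟩ := Nat.exists_eq_succ_of_ne_zero hI.card_ne_zero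
      by_cases hIJ : I ⊆ J <;> simp [hI, hI.ne_empty, hIJ, hn, pow_succ]
  have hpowerset : ∑ I : Finset ι, (if I ⊆ J then (-1) ^ I.card * v else 0) = 0 := by
    have hzero := congrArg (Int.cast (R := R)) (Finset.sum_powerset_neg_one_pow_card_of_nonempty hJ)
    push_cast at hzero
    rw [← Finset.sum_filter, Finset.filter_subset_univ, ← Finset.sum_mul, hzero, zero_mul]
  rw [Finset.sum_filter, Finset.sum_congr rfl fun I _ => hterm I, Finset.sum_sub_distrib,
    hpowerset]
  simp

theorem isSteinerPolynomial_closedShell_contactSet (hJ : ∀ j ∈ J, IsConvexBody (K j))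
    (hj₀ : j₀ ∈ J) {G : ℝ[X]} (hGdeg : G.natDegree ≤ d)
    (hG : ∀ s : ℝ, 0 < s → (volume (shell (K j₀) (contactSet K J j₀ ρ) s)).toReal = G.eval s)
    (hε : 0 < ε) (hIJ : I ⊆ J) (hI : I.Nonempty) :
    IsSteinerPolynomial (⋂ i ∈ I, Metric.cthickening ε (K i))
      (closedShell (K j₀) (contactSet K J j₀ ρ) ε ε)
      (taylor ε G +
        C ((volume (closedShell (K j₀) (contactSet K J j₀ ρ) ε ε)).toReal - G.eval ε)) where
  natDegree_le := by rwa [natDegree_add_C, natDegree_taylor]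
  eval_eq η hη := by
    rw [(localParallelSet_closedShell_contactSet_subset hJ hj₀ hε hIJ).antisymm
        (closedShell_contactSet_subset_localParallelSet hJ hj₀ hε hIJ hI),
      (hJ j₀ hj₀).toReal_measure_closedShell volume (measurableSet_contactSet hJ hj₀) hε
        (by linarith), hG ε hε, hG (ε + η) (by linarith), eval_add, eval_C, taylor_eval,
      add_comm η ε]
    ring

-- All the intersections that meet the contact surface have the same curvature there, so that
-- inclusion-exclusion leaves a single term.
theorem IsConvexRepr.curvature_cthickening_closedShell_contactSet (h : IsConvexRepr A m K)
    (hJ : ∀ j ∈ J, IsConvexBody (K j)) (hj₀ : j₀ ∈ J) {G : ℝ[X]} (hGdeg : G.natDegree ≤ d)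
    (hG : ∀ s : ℝ, 0 < s → (volume (shell (K j₀) (contactSet K J j₀ ρ) s)).toReal = G.eval s)
    (hε : 0 < ε) (hρ : 2 * ε ≤ ρ) (k : Fin d) :
    curvature k.castSucc (Metric.cthickening ε A)
        (closedShell (K j₀) (contactSet K J j₀ ρ) ε ε) =
      (taylor ε G).coeff (d - k) / unitBallVolume (d - k) := by
  classical
  rw [(h.cthickening ε).curvature_eq
    ((hJ j₀ hj₀).measurableSet_closedShell (measurableSet_contactSet hJ hj₀) ε ε)]
  refine (Finset.sum_congr rfl fun I hI => ?_).trans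
    (sum_neg_one_pow_card_sub_one_mul_ite_subset ⟨j₀, hj₀⟩ _)
  congr 1
  split_ifs with hIJ
  · rw [(isSteinerPolynomial_closedShell_contactSet hJ hj₀ hGdeg hG hε hIJ
      (Finset.mem_filter.1 hI).2).convexCurvature_eq, Fin.val_castSucc, coeff_add,
      coeff_C_of_ne_zero (Nat.sub_ne_zero_of_lt k.2), add_zero]
  · refine convexCurvature_eq_zero (eq_empty_of_forall_notMem fun y hy => hIJ fun i hi => ?_) _
    exact mem_of_mem_closedShell_contactSet hε.le hρ hy.2 (mem_iInter₂.1 hy.1 i hi)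

theorem tendsto_coeff_taylor_nhds_zero (G : ℝ[X]) (n : ℕ) :
    Tendsto (fun ε => (taylor ε G).coeff n) (𝓝 0) (𝓝 (G.coeff n)) := by
  have hlim := (hasseDeriv n G).continuous.tendsto 0
  rw [← taylor_coeff, taylor_zero] at hlim
  simpa only [taylor_coeff] using hlim

theorem IsConvexRepr.scalingExponent_eq_zero_of_shell_contactSet (h : IsConvexRepr A m K)
    (hJ : ∀ j ∈ J, IsConvexBody (K j)) (hj₀ : j₀ ∈ J) (hρ : 0 < ρ) {R : ℝ} (hR : 0 < R)
    {k : Fin d}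
    (hcurved : volume (shell (K j₀) (contactSet K J j₀ ρ) R ∩ curvedPoints (K j₀) k) ≠ 0) :
    scalingExponent k.castSucc A = 0 := by
  have hmeas : MeasurableSet (contactSet K J j₀ ρ) := measurableSet_contactSet hJ hj₀
  obtain ⟨G, hGdeg, hG, hGpos⟩ := (hJ j₀ hj₀).exists_polynomial_eval_eq_measure_shell volume hmeas
    (isRayInvariant_contactSet hJ hj₀) hR
  rw [finrank_euclideanSpace_fin] at hGdeg hGpos
  refine h.scalingExponent_eq_zero_of_tendsto
    (div_pos (hGpos k k.2.le hcurved) (unitBallVolume_pos (d - k)))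
    (((tendsto_coeff_taylor_nhds_zero G _).mono_left nhdsWithin_le_nhds).div_const _) ?_
  filter_upwards [Ioo_mem_nhdsGT (zero_lt_one' ℝ), Ioo_mem_nhdsGT (half_pos hρ)] with ε hε₁ hερ
  rw [← h.curvature_cthickening_closedShell_contactSet hJ hj₀ hGdeg hG hε₁.1
    (by linarith [hερ.2]) k]
  exact (le_abs_self _).trans (h.abs_curvature_cthickening_le_curvatureVar hε₁.2.le
    ((hJ j₀ hj₀).measurableSet_closedShell hmeas ε ε))

end Curvature

/-! ### Mixing foot points and normals -/

section FootNormal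

variable {V : Type*} [NormedAddCommGroup V] [InnerProductSpace ℝ V] [FiniteDimensional ℝ V]
  {W : Submodule ℝ V} {K : Set V}

theorem exists_submodule_finrank_eq {F : Type*} [DivisionRing F] {M : Type*} [AddCommGroup M]
    [Module F M] {k : ℕ} (hk : k ≤ Module.finrank F M) :
    ∃ W : Submodule F M, Module.finrank F W = k := by
  obtain ⟨v, hv⟩ := exists_linearIndependent_of_le_finrank hk
  exact ⟨Submodule.span F (range v), by rw [finrank_span_eq_card hv, Fintype.card_fin]⟩

theorem starProjection_starProjection (x : V) :
    W.starProjection (W.starProjection x) = W.starProjection x :=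
  Submodule.starProjection_eq_self_iff.2 (W.starProjection_apply_mem x)

theorem starProjection_starProjection_orthogonal (x : V) :
    W.starProjection (Wᗮ.starProjection x) = 0 :=
  W.starProjection_apply_eq_zero_iff.2 (Wᗮ.starProjection_apply_mem x)

theorem starProjection_orthogonal_starProjection (x : V) :
    Wᗮ.starProjection (W.starProjection x) = 0 :=
  Submodule.starProjection_orthogonal_apply_eq_zero (W.starProjection_apply_mem x)

theorem finrank_le_finrank_range_of_surjective {D D' : V →L[ℝ] V}
    (h : Function.Surjective (W.starProjection ∘L D + Wᗮ.starProjection ∘L D')) :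
    Module.finrank ℝ W ≤ Module.finrank ℝ D.toLinearMap.range := by
  refine (Submodule.finrank_mono fun w hw => ?_).trans
    (Submodule.finrank_map_le W.starProjection.toLinearMap D.toLinearMap.range)
  obtain ⟨x, hx⟩ := h w
  refine ⟨D x, ⟨x, rfl⟩, ?_⟩
  have hproj := congrArg W.starProjection hx
  rwa [_root_.add_apply, ContinuousLinearMap.comp_apply, ContinuousLinearMap.comp_apply, map_add,
    starProjection_starProjection, starProjection_starProjection_orthogonal, add_zero,
    Submodule.starProjection_eq_self_iff.2 hw] at hproj

/-- The component in `W` of the foot point of `x` in `K`, plus the component in `Wᗮ` of the normal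
from the foot point to `x`. It serves to detect curvature: its derivative can be invertible only at
points of `curvedPoints K (finrank W)`. -/
noncomputable def footNormalMap (W : Submodule ℝ V) (K : Set V) (x : V) : V :=
  W.starProjection (nearestPoint K x) + Wᗮ.starProjection (x - nearestPoint K x)

theorem IsConvexBody.exists_lipschitzWith_footNormalMap (hK : IsConvexBody K) :
    ∃ C, LipschitzWith C (footNormalMap W K) :=
  ⟨_, (W.starProjection.lipschitz.comp hK.lipschitzWith_nearestPoint).add
    (Wᗮ.starProjection.lipschitz.comp (LipschitzWith.id.sub hK.lipschitzWith_nearestPoint))⟩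

theorem hasFDerivAt_footNormalMap {x : V} (h : DifferentiableAt ℝ (nearestPoint K) x) :
    HasFDerivAt (footNormalMap W K)
      (W.starProjection ∘L fderiv ℝ (nearestPoint K) x +
        Wᗮ.starProjection ∘L (ContinuousLinearMap.id ℝ V - fderiv ℝ (nearestPoint K) x)) x :=
  (W.starProjection.hasFDerivAt.comp x h.hasFDerivAt).add
    (Wᗮ.starProjection.hasFDerivAt.comp x ((hasFDerivAt_id x).sub h.hasFDerivAt))

theorem mem_curvedPoints_of_det_ne_zero {x : V} (h : DifferentiableAt ℝ (nearestPoint K) x)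
    (hdet : (W.starProjection ∘L fderiv ℝ (nearestPoint K) x + Wᗮ.starProjection ∘L
      (ContinuousLinearMap.id ℝ V - fderiv ℝ (nearestPoint K) x)).det ≠ 0) :
    x ∈ curvedPoints K (Module.finrank ℝ W) := by
  have hsurj := (LinearMap.equivOfDetNeZero _ hdet).surjective
  refine ⟨h, finrank_le_finrank_range_of_surjective hsurj, ?_⟩
  rw [← W.finrank_add_finrank_orthogonal, Nat.add_sub_cancel_left]
  refine finrank_le_finrank_range_of_surjective (D' := fderiv ℝ (nearestPoint K) x) ?_
  simp only [Submodule.orthogonal_orthogonal]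
  rwa [add_comm]

-- Rademacher's theorem disposes of the points without derivative, Sard's theorem of those where
-- the derivative is singular.
theorem IsConvexBody.measure_image_footNormalMap_eq_zero [MeasurableSpace V] [BorelSpace V]
    {μ : Measure V} [μ.IsAddHaarMeasure] (hK : IsConvexBody K) {S : Set V}
    (hS : μ (S ∩ curvedPoints K (Module.finrank ℝ W)) = 0) : μ (footNormalMap W K '' S) = 0 := by
  obtain ⟨C, hC⟩ := hK.exists_lipschitzWith_footNormalMap (W := W)
  set D := {x | DifferentiableAt ℝ (nearestPoint K) x}
  set U := curvedPoints K (Module.finrank ℝ W)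
  have hsingular : μ (footNormalMap W K '' (D \ U)) = 0 :=
    addHaar_image_eq_zero_of_det_fderivWithin_eq_zero μ
      (fun x hx => (hasFDerivAt_footNormalMap hx.1).hasFDerivWithinAt)
      fun x hx => by_contra fun hdet => hx.2 (mem_curvedPoints_of_det_ne_zero hx.1 hdet)
  have hnondiff : μ (footNormalMap W K '' Dᶜ) = 0 := measure_image_eq_zero_of_lipschitzWith hC
    hK.lipschitzWith_nearestPoint.ae_differentiableAt
  have hcover : S ⊆ S ∩ U ∪ (D \ U ∪ Dᶜ) := fun x hx => by
    by_cases hU : x ∈ U <;> by_cases hD : x ∈ D <;> simp [hx, hU, hD]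
  refine measure_mono_null (image_mono hcover) ?_
  rw [image_union, image_union]
  exact measure_union_null (measure_image_eq_zero_of_lipschitzWith hC hS)
    (measure_union_null hsingular hnondiff)

end FootNormal

/-! ### Common normals -/

section SlicePenalty

variable {V : Type*} [NormedAddCommGroup V] [InnerProductSpace ℝ V] {K : Set V} {z v : V} {f : ℝ}

theorem mul_inner_add_mul_inner_le_of_slice {F : Type*} [AddCommGroup F] [Module ℝ F]
    (T : V →ₗ[ℝ] F) (hK : Convex ℝ K) (hf : ∀ q ∈ K, T q = T z → inner ℝ v q ≤ f) {q q' : V}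
    (hq : q ∈ K) (hq' : q' ∈ K) {t θ : ℝ} (ht : 0 < t) (hθ : 0 < θ)
    (hT : t • (T q - T z) + θ • (T q' - T z) = 0) :
    t * inner ℝ v q + θ * inner ℝ v q' ≤ (t + θ) * f := by
  have hsum : 0 < t + θ := by positivity
  have hmem : (t / (t + θ)) • q + (θ / (t + θ)) • q' ∈ K :=
    hK hq hq' (by positivity) (by positivity) (by field_simp)
  have hslice : T ((t / (t + θ)) • q + (θ / (t + θ)) • q') = T z := by
    have hcombine : (t / (t + θ)) • T q + (θ / (t + θ)) • T q' - ((t + θ) / (t + θ)) • T z =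
        (t + θ)⁻¹ • (t • (T q - T z) + θ • (T q' - T z)) := by module
    rw [hT, smul_zero, div_self hsum.ne', one_smul, sub_eq_zero] at hcombine
    rw [map_add, map_smul, map_smul, hcombine]
  have hle := hf _ hmem hslice
  rw [inner_add_right, inner_smul_right, inner_smul_right, div_mul_eq_mul_div,
    div_mul_eq_mul_div, ← add_div, div_le_iff₀ hsum] at hle
  linarith

theorem eventually_inner_sub_mul_norm_le_of_notMem_image {F : Type*} [NormedAddCommGroup F]
    [NormedSpace ℝ F] (T : V →L[ℝ] F) (hK : IsCompact K) (hz : T z ∉ T '' K) (v : V) (f : ℝ) :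
    ∀ᶠ L : ℝ in atTop, ∀ q ∈ K, inner ℝ v q - L * ‖T q - T z‖ ≤ f := by
  obtain ⟨R, hR⟩ := hK.isBounded.exists_norm_le
  obtain ⟨δ, hδ, hball⟩ :=
    Metric.isOpen_iff.1 (hK.image T.continuous).isClosed.isOpen_compl (T z) hz
  filter_upwards [eventually_ge_atTop ((‖v‖ * R - f) / δ), eventually_ge_atTop 0] with L hL hL₀ q hq
  have hfar : δ ≤ ‖T q - T z‖ := not_lt.1 fun hlt =>
    hball (mem_ball_iff_norm.2 hlt) (mem_image_of_mem T hq)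
  have hinner : inner ℝ v q ≤ ‖v‖ * R :=
    (real_inner_le_norm v q).trans (by gcongr; exact hR q hq)
  have hpenalty : L * δ ≤ L * ‖T q - T z‖ := by gcongr
  linarith [(div_le_iff₀ hδ).1 hL]

variable [FiniteDimensional ℝ V] {W : Submodule ℝ V}

-- A point `q` of `K` outside the slice through `z` is balanced by a point of `K` on the other side
-- of the slice, at a distance from it that is bounded below.
theorem eventually_inner_sub_mul_norm_le_of_mem_interior (hK : Convex ℝ K)
    (hbdd : Bornology.IsBounded K)
    (hz : z ∈ interior (W.starProjection ⁻¹' (W.starProjection '' K)))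
    (hf : ∀ q ∈ K, W.starProjection q = W.starProjection z → inner ℝ v q ≤ f) :
    ∀ᶠ L : ℝ in atTop, ∀ q ∈ K,
      inner ℝ v q - L * ‖W.starProjection q - W.starProjection z‖ ≤ f := by
  obtain ⟨R, hR⟩ := hbdd.exists_norm_le
  obtain ⟨t, ht, hball⟩ := Metric.nhds_basis_closedBall.mem_iff.1 (mem_interior_iff_mem_nhds.1 hz)
  filter_upwards [eventually_ge_atTop ((f + ‖v‖ * R) / t)] with L hL q hq
  set w := W.starProjection q - W.starProjection z with hw
  rcases eq_or_ne w 0 with hw₀ | hw₀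
  · rw [hw₀, norm_zero, mul_zero, sub_zero]
    exact hf q hq (sub_eq_zero.1 hw₀)
  have hpos : 0 < ‖w‖ := norm_pos_iff.2 hw₀
  obtain ⟨q', hq', hproj⟩ : z - (t / ‖w‖) • w ∈ W.starProjection ⁻¹' (W.starProjection '' K) :=
    hball (by
      rw [Metric.mem_closedBall, dist_eq_norm, sub_sub_cancel_left, norm_neg, norm_smul,
        Real.norm_of_nonneg (by positivity), div_mul_cancel₀ _ hpos.ne'])
  have hwself : W.starProjection w = w := by rw [hw, ← map_sub, starProjection_starProjection]
  rw [map_sub, map_smul, hwself] at hproj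
  have hbalance := mul_inner_add_mul_inner_le_of_slice W.starProjection.toLinearMap hK hf hq hq'
    ht hpos (by
      simp only [ContinuousLinearMap.coe_coe]
      rw [hproj, ← hw, sub_sub_cancel_left, smul_neg, smul_smul, mul_div_cancel₀ _ hpos.ne',
        add_neg_cancel])
  have hinner : -(‖v‖ * R) ≤ inner ℝ v q' :=
    (neg_le_neg (by gcongr; exact hR q' hq')).trans
      (neg_le_of_abs_le (abs_real_inner_le_norm v q'))
  have hslope : (f + ‖v‖ * R) * ‖w‖ ≤ L * t * ‖w‖ := by
    gcongr
    exact (div_le_iff₀ ht).1 hL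
  refine le_of_mul_le_mul_left ?_ ht
  nlinarith

theorem eventually_inner_sub_mul_norm_le (hK : IsCompact K) (hconv : Convex ℝ K)
    (hz : z ∉ frontier (W.starProjection ⁻¹' (W.starProjection '' K)))
    (hf : ∀ q ∈ K, W.starProjection q = W.starProjection z → inner ℝ v q ≤ f) :
    ∀ᶠ L : ℝ in atTop, ∀ q ∈ K,
      inner ℝ v q - L * ‖W.starProjection q - W.starProjection z‖ ≤ f := by
  by_cases hmem : z ∈ W.starProjection ⁻¹' (W.starProjection '' K)
  · exact eventually_inner_sub_mul_norm_le_of_mem_interior hconv hK.isBounded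
      (by_contra fun hint => hz ⟨subset_closure hmem, hint⟩) hf
  · exact eventually_inner_sub_mul_norm_le_of_notMem_image W.starProjection hK hmem v f

end SlicePenalty

section SliceSupport

variable {V : Type*} [NormedAddCommGroup V] [InnerProductSpace ℝ V] [FiniteDimensional ℝ V]
  {W : Submodule ℝ V} {A : Set V} {z q : V}

/-- The support function in direction `z` of the slice of `A` through `z` orthogonal to `W`, relaxed
to all of `A` by a penalty of slope `L` on leaving the slice. The penalty makes it Lipschitz in
`z`. -/
noncomputable def sliceSupport (W : Submodule ℝ V) (A : Set V) (L : ℝ) (z : V) : ℝ :=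
  sSup ((fun q => inner ℝ (Wᗮ.starProjection z) q -
    L * ‖W.starProjection q - W.starProjection z‖) '' A)

theorem le_sliceSupport (hA : IsCompact A) (L : ℝ) (z : V) (hq : q ∈ A) :
    inner ℝ (Wᗮ.starProjection z) q - L * ‖W.starProjection q - W.starProjection z‖ ≤
      sliceSupport W A L z :=
  le_csSup (hA.image (by fun_prop)).bddAbove (mem_image_of_mem _ hq)

theorem exists_eq_sliceSupport (hA : IsCompact A) (hne : A.Nonempty) (L : ℝ) (z : V) :
    ∃ q ∈ A, inner ℝ (Wᗮ.starProjection z) q - L * ‖W.starProjection q - W.starProjection z‖ =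
      sliceSupport W A L z :=
  (hA.image (by fun_prop)).sSup_mem (hne.image _)

theorem exists_lipschitzWith_sliceSupport (hA : IsCompact A) (hne : A.Nonempty) {L : ℝ}
    (hL : 0 ≤ L) : ∃ C, LipschitzWith C (sliceSupport W A L) := by
  obtain ⟨R, hR⟩ := hA.isBounded.exists_norm_le
  have hR₀ : 0 ≤ R := (norm_nonneg _).trans (hR _ hne.some_mem)
  refine ⟨(R + L).toNNReal, LipschitzWith.of_le_add_mul _ fun x y => ?_⟩
  obtain ⟨q, hq, hqx⟩ := exists_eq_sliceSupport (W := W) hA hne L x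
  have hy := le_sliceSupport (W := W) hA L y hq
  have hinner : inner ℝ (Wᗮ.starProjection x) q - inner ℝ (Wᗮ.starProjection y) q ≤
      R * dist x y := by
    rw [← inner_sub_left, ← map_sub, dist_eq_norm, mul_comm]
    refine (real_inner_le_norm _ _).trans ?_
    gcongr
    · exact Wᗮ.norm_starProjection_apply_le _
    · exact hR q hq
  have hnorm : ‖W.starProjection q - W.starProjection y‖ - ‖W.starProjection q -
      W.starProjection x‖ ≤ dist x y := by
    refine (norm_sub_norm_le _ _).trans ?_
    rw [sub_sub_sub_cancel_left, ← map_sub, dist_eq_norm]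
    exact W.norm_starProjection_apply_le _
  have hpenalty := mul_le_mul_of_nonneg_left hnorm hL
  rw [← hqx, Real.coe_toNNReal _ (by positivity), add_mul]
  linarith

-- The normal combines `z`, along the slice, with the gradient of the slice support function,
-- across the slices.
theorem exists_inner_sub_nonpos_of_segment_subset (hA : IsCompact A) {L : ℝ}
    (hdiff : DifferentiableAt ℝ (sliceSupport W A L) z)
    (hq : W.starProjection q = W.starProjection z)
    (hmax : sliceSupport W A L z = inner ℝ (Wᗮ.starProjection z) q) :
    ∃ u, Wᗮ.starProjection u = Wᗮ.starProjection z ∧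
      ∀ q', segment ℝ q q' ⊆ A → inner ℝ u (q' - q) ≤ 0 := by
  set S := sliceSupport W A L
  set a := (InnerProductSpace.toDual ℝ V).symm (fderiv ℝ S z)
  refine ⟨Wᗮ.starProjection z - W.starProjection a, by
    rw [map_sub, starProjection_starProjection, starProjection_orthogonal_starProjection,
      sub_zero], fun q' hq' => ?_⟩
  set w := W.starProjection (q' - q) with hw
  have hslope := (hdiff.hasFDerivAt.hasLineDerivAt w).tendsto_slope_zero_right
  have hgrad : inner ℝ (Wᗮ.starProjection z) (q' - q) ≤ fderiv ℝ S z w := by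
    refine ge_of_tendsto hslope ?_
    filter_upwards [Ioo_mem_nhdsGT (zero_lt_one' ℝ)] with t ht
    have hmem : q + t • (q' - q) ∈ A := hq' (by
      rw [segment_eq_image']
      exact mem_image_of_mem _ ⟨ht.1.le, ht.2.le⟩)
    have hle := le_sliceSupport (W := W) hA L (z + t • w) hmem
    simp only [map_add, map_smul, hw, starProjection_starProjection,
      starProjection_orthogonal_starProjection, hq, sub_self, norm_zero, mul_zero, sub_zero,
      smul_zero, add_zero, inner_add_right, inner_smul_right, ← hmax] at hle
    rw [smul_eq_mul, ← div_eq_inv_mul, le_div_iff₀ ht.1]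
    linarith
  have hinner : fderiv ℝ S z w = inner ℝ (W.starProjection a) (q' - q) := by
    rw [W.inner_starProjection_left_eq_right, ← hw, InnerProductSpace.toDual_symm_apply]
  rw [inner_sub_left]
  linarith

variable {ι : Type*} [Finite ι] {K : ι → Set V}

theorem exists_mem_sliceSupport_iUnion_eq (hK : ∀ i, IsCompact (K i)) (hconv : ∀ i, Convex ℝ (K i))
    (hz : ∀ i, z ∉ frontier (W.starProjection ⁻¹' (W.starProjection '' K i)))
    (hmem : z ∈ ⋃ i, K i) :
    ∃ q ∈ ⋃ i, K i, W.starProjection q = W.starProjection z ∧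
      ∃ L : ℕ, sliceSupport W (⋃ i, K i) L z = inner ℝ (Wᗮ.starProjection z) q := by
  have hcompact : IsCompact (⋃ i, K i) := isCompact_iUnion hK
  obtain ⟨q, ⟨hq, hproj : W.starProjection q = W.starProjection z⟩, hmax⟩ := (hcompact.inter_right
    (isClosed_eq W.starProjection.continuous continuous_const)).exists_isMaxOn ⟨z, hmem, rfl⟩
    (f := fun q => inner ℝ (Wᗮ.starProjection z) q) (by fun_prop)
  obtain ⟨L, hL⟩ := (tendsto_natCast_atTop_atTop.eventually (eventually_all.2 fun i =>
    eventually_inner_sub_mul_norm_le (hK i) (hconv i) (hz i) fun q' hq' hproj' =>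
      hmax ⟨mem_iUnion_of_mem i hq', hproj'⟩)).exists
  refine ⟨q, hq, hproj, L, le_antisymm ?_ ?_⟩
  · obtain ⟨q', hq', heq⟩ := exists_eq_sliceSupport (W := W) hcompact ⟨z, hmem⟩ L z
    obtain ⟨i, hi⟩ := mem_iUnion.1 hq'
    exact heq ▸ hL i q' hi
  · have hle := le_sliceSupport (W := W) hcompact L z hq
    rwa [hproj, sub_self, norm_zero, mul_zero, sub_zero] at hle

theorem ae_exists_common_normal [MeasurableSpace V] [BorelSpace V] (μ : Measure V)
    [μ.IsAddHaarMeasure] (hK : ∀ i, IsCompact (K i)) (hconv : ∀ i, Convex ℝ (K i)) :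
    ∀ᵐ z ∂μ, z ∈ ⋃ i, K i → ∃ q ∈ ⋃ i, K i, ∃ u,
      W.starProjection q + Wᗮ.starProjection u = z ∧
      ∀ i, q ∈ K i → ∀ q' ∈ K i, inner ℝ u (q' - q) ≤ 0 := by
  rcases (⋃ i, K i).eq_empty_or_nonempty with hempty | hne
  · simp [hempty]
  have hcompact : IsCompact (⋃ i, K i) := isCompact_iUnion hK
  have hdiff : ∀ᵐ z ∂μ, ∀ L : ℕ, DifferentiableAt ℝ (sliceSupport W (⋃ i, K i) L) z :=
    ae_all_iff.2 fun L =>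
      let ⟨_, hC⟩ := exists_lipschitzWith_sliceSupport hcompact hne L.cast_nonneg
      hC.ae_differentiableAt
  have hfrontier : ∀ᵐ z ∂μ, ∀ i,
      z ∉ frontier (W.starProjection ⁻¹' (W.starProjection '' K i)) :=
    ae_all_iff.2 fun i => measure_eq_zero_iff_ae_notMem.1 <|
      (((hconv i).linear_image W.starProjection.toLinearMap).linear_preimage
        W.starProjection.toLinearMap).addHaar_frontier μ
  filter_upwards [hdiff, hfrontier] with z hdz hfz hz
  obtain ⟨q, hq, hproj, L, hmax⟩ := exists_mem_sliceSupport_iUnion_eq hK hconv hfz hz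
  obtain ⟨u, hu, hnormal⟩ :=
    exists_inner_sub_nonpos_of_segment_subset hcompact (hdz L) hproj hmax
  refine ⟨q, hq, u, ?_, fun i hi q' hq' => hnormal q' ?_⟩
  · rw [hproj, hu, W.starProjection_add_starProjection_orthogonal]
  · exact ((hconv i).segment_subset hi hq').trans (subset_iUnion K i)

end SliceSupport

/-! ### Curvature of polyconvex sets of positive volume -/

section Covering

theorem eventually_ofReal_lt_infEDist_of_notMem {X ι : Type*} [PseudoEMetricSpace X] [Finite ι]
    {K : ι → Set X} (hK : ∀ i, IsClosed (K i)) (q : X) :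
    ∀ᶠ n : ℕ in atTop, ∀ i, q ∉ K i →
      ENNReal.ofReal (1 / ((n : ℝ) + 1)) < Metric.infEDist q (K i) := by
  refine eventually_all.2 fun i => ?_
  rcases em (q ∈ K i) with hq | hq
  · exact .of_forall fun _ hn => absurd hq hn
  have hpos : 0 < Metric.infEDist q (K i) :=
    pos_iff_ne_zero.2 fun hzero => hq ((Metric.mem_iff_infEDist_zero_of_closed (hK i)).2 hzero)
  have hlim : Tendsto (fun n : ℕ => ENNReal.ofReal (1 / ((n : ℝ) + 1))) atTop (𝓝 0) := by
    simpa using ENNReal.tendsto_ofReal (tendsto_one_div_add_atTop_nhds_zero_nat (𝕜 := ℝ))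
  filter_upwards [hlim.eventually (eventually_lt_nhds hpos)] with n hn _ using hn

variable {V ι : Type*} [NormedAddCommGroup V] [InnerProductSpace ℝ V] [Finite ι] {K : ι → Set V}

theorem exists_add_mem_shell_contactSet (hK : ∀ i, IsCompact (K i)) (hconv : ∀ i, Convex ℝ (K i))
    {j₀ : ι} {q u : V} (hq : q ∈ K j₀) (hu : u ≠ 0)
    (hnormal : ∀ i, q ∈ K i → ∀ q' ∈ K i, inner ℝ u (q' - q) ≤ 0) :
    nearestPoint (K j₀) (q + u) = q ∧ ∃ (J : Finset ι) (n : ℕ),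
      (j₀ ∈ J ∧ ∀ j ∈ J, IsConvexBody (K j)) ∧
      q + u ∈ shell (K j₀) (contactSet K J j₀ (1 / ((n : ℝ) + 1))) (n + 1) := by
  classical
  have := Fintype.ofFinite ι
  have hbody : ∀ j, q ∈ K j → IsConvexBody (K j) := fun j hj => ⟨hK j, hconv j, q, hj⟩
  have hnear : ∀ j, q ∈ K j → nearestPoint (K j) (q + u) = q := fun j hj =>
    (hbody j hj).nearestPoint_eq_of_inner_nonpos hj fun q' hq' => by
      rw [add_sub_cancel_left]
      exact hnormal j hj q' hq'
  obtain ⟨n, hfar, hn⟩ := ((eventually_ofReal_lt_infEDist_of_notMem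
    (fun i => (hK i).isClosed) q).and (tendsto_natCast_atTop_atTop.eventually_ge_atTop ‖u‖)).exists
  refine ⟨hnear j₀ hq, Finset.univ.filter (q ∈ K ·), n, ⟨by simpa using hq, by simpa using hbody⟩,
    ⟨fun j hj => ?_, fun j hj => ?_⟩, ?_⟩
  · rw [hnear j (by simpa using hj), hnear j₀ hq]
  · rw [hnear j₀ hq]
    exact hfar j (by simpa using hj)
  · rw [mem_ofPred_eq, hnear j₀ hq, dist_eq_norm, add_sub_cancel_left]
    exact ⟨norm_pos_iff.2 hu, by linarith⟩

variable [FiniteDimensional ℝ V] [MeasurableSpace V] [BorelSpace V]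
  {W : Submodule ℝ V}

theorem ae_exists_mem_image_footNormalMap (μ : Measure V) [μ.IsAddHaarMeasure]
    (hK : ∀ i, IsCompact (K i)) (hconv : ∀ i, Convex ℝ (K i)) (hW : W ≠ ⊤) :
    ∀ᵐ z ∂μ, z ∈ ⋃ i, K i → ∃ (J : Finset ι) (j₀ : ι) (n : ℕ),
      (j₀ ∈ J ∧ ∀ j ∈ J, IsConvexBody (K j)) ∧
      z ∈ footNormalMap W (K j₀) ''
        shell (K j₀) (contactSet K J j₀ (1 / ((n : ℝ) + 1))) (n + 1) := by
  filter_upwards [ae_exists_common_normal (W := W) μ hK hconv,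
    measure_eq_zero_iff_ae_notMem.1 (Measure.addHaar_submodule μ W hW)] with z hcommon hzW hz
  obtain ⟨q, hq, u, hqu, hnormal⟩ := hcommon hz
  obtain ⟨j₀, hj₀⟩ := mem_iUnion.1 hq
  have hu : u ≠ 0 := by
    rintro rfl
    rw [map_zero, add_zero] at hqu
    exact hzW (hqu ▸ W.starProjection_apply_mem q)
  obtain ⟨hnear, J, n, hJ, hmem⟩ := exists_add_mem_shell_contactSet hK hconv hj₀ hu hnormal
  refine ⟨J, j₀, n, hJ, q + u, hmem, ?_⟩
  rw [footNormalMap, hnear, add_sub_cancel_left, hqu]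

theorem exists_measure_shell_contactSet_inter_curvedPoints_ne_zero {μ : Measure V}
    [μ.IsAddHaarMeasure] (hK : ∀ i, IsCompact (K i)) (hconv : ∀ i, Convex ℝ (K i))
    (hpos : 0 < μ (⋃ i, K i)) {k : ℕ} (hk : k < Module.finrank ℝ V) :
    ∃ (J : Finset ι) (j₀ : ι) (n : ℕ), (j₀ ∈ J ∧ ∀ j ∈ J, IsConvexBody (K j)) ∧
      μ (shell (K j₀) (contactSet K J j₀ (1 / ((n : ℝ) + 1))) (n + 1) ∩
        curvedPoints (K j₀) k) ≠ 0 := by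
  obtain ⟨W, rfl⟩ := exists_submodule_finrank_eq hk.le
  have hW : W ≠ ⊤ := by
    rintro rfl
    exact hk.ne (finrank_top ℝ V)
  by_contra! hnull
  have himage : ∀ᵐ z ∂μ, ∀ (J : Finset ι) (j₀ : ι) (n : ℕ),
      (j₀ ∈ J ∧ ∀ j ∈ J, IsConvexBody (K j)) → z ∉ footNormalMap W (K j₀) ''
        shell (K j₀) (contactSet K J j₀ (1 / ((n : ℝ) + 1))) (n + 1) := by
    simp only [ae_all_iff]
    exact fun J j₀ n hJ => measure_eq_zero_iff_ae_notMem.1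
      ((hJ.2 j₀ hJ.1).measure_image_footNormalMap_eq_zero (hnull J j₀ n hJ))
  refine hpos.ne' (measure_eq_zero_iff_ae_notMem.2 ?_)
  filter_upwards [ae_exists_mem_image_footNormalMap μ hK hconv hW, himage] with z hcover hz hmem
  obtain ⟨J, j₀, n, hJ, hzJ⟩ := hcover hmem
  exact hz J j₀ n hJ hzJ

end Covering

theorem IsConvexRepr.scalingExponent_castSucc {d m : ℕ} {A : Set (E d)} {K : Fin m → Set (E d)}
    (h : IsConvexRepr A m K) (hpos : 0 < volume A) (k : Fin d) :
    scalingExponent k.castSucc A = 0 := by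
  rw [h.2] at hpos
  obtain ⟨J, j₀, n, ⟨hj₀, hJ⟩, hcurved⟩ :=
    exists_measure_shell_contactSet_inter_curvedPoints_ne_zero (fun i => (h.1 i).1)
      (fun i => (h.1 i).2) hpos (k.2.trans_eq finrank_euclideanSpace_fin.symm)
  exact h.scalingExponent_eq_zero_of_shell_contactSet hJ hj₀ (by positivity) (by positivity) hcurved

theorem IsPolyconvex.scalingExponent_eq_zero {d : ℕ} {A : Set (E d)} (hA : IsPolyconvex A)
    (hpos : 0 < volume A) (j : Fin (d + 1)) : scalingExponent j A = 0 := by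
  obtain ⟨m, K, h⟩ := hA
  induction j using Fin.lastCases with
  | last => exact h.scalingExponent_last hpos
  | cast k => exact h.scalingExponent_castSucc hpos k

end FractalCurvature

theorem mainTheorem5 {d : ℕ} (k : Fin d) (A : Set (FractalCurvature.E d))
    (hA : FractalCurvature.SpecificCurvatureWellDefined A) (r : ℝ) (hr : 0 < r) :
    (FractalCurvature.IsPolyconvex A → 0 < volume A →
      FractalCurvature.SpecificCurvatureWellDefined (r • A) ∧
      FractalCurvature.specificCurvature k (r • A) =
        r ^ (((k : ℕ) : ℤ) - (d : ℤ)) * FractalCurvature.specificCurvature k A) ∧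
    (∀ s : ℝ, (∀ j : Fin (d + 1),
        FractalCurvature.scalingExponent j A = ((s - ((j : ℕ) : ℝ) : ℝ) : EReal)) →
      FractalCurvature.SpecificCurvatureWellDefined (r • A) ∧
      FractalCurvature.specificCurvature k (r • A) = FractalCurvature.specificCurvature k A) := by
  refine ⟨fun hpoly hpos => ?_, fun s hs => ?_⟩
  · have hs : ∀ j, FractalCurvature.scalingExponent j A = ((0 : ℝ) : EReal) :=
      hpoly.scalingExponent_eq_zero hpos
    obtain ⟨hdefined, hscale⟩ :=
      FractalCurvature.specificCurvature_smul hA hr (s := fun _ => 0) hs k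
    refine ⟨hdefined, hscale.trans ?_⟩
    rw [← Real.rpow_intCast]
    push_cast
    simp only [zero_add]
  · obtain ⟨hdefined, hscale⟩ :=
      FractalCurvature.specificCurvature_smul hA hr (s := fun j => s - (j : ℕ)) hs k
    exact ⟨hdefined, hscale.trans (by simp)⟩
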